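/- **Setting.** The system has a finite-dimensional Hilbert space ${\cal H}_S$, the ancillas are identical with finite-dimensional space ${\cal H}$ and orthonormal basis $\{|i\rangle\}$. The ancillas $1,2,\dots$ are in a right-canonical matrix product density operator with site-independent finite-dimensional tensors: matrices $B_b^{i}$ with $\sum_{i,b}B_b^i(B_b^i)^\dagger=I$, a density matrix $\chi_0$ on the bond space, $M^{ii'}=\sum_b B_b^i\otimes\overline{B_b^{i'}}$, and, for every $n$, $$\langle i_1\ldots i_n|\varrho_{1\ldots n}|i_1'\ldots i_n'\rangle=\sum_{a_0,a_0',a}(\chi_0)_{a_0a_0'}\big(M^{i_1i_1'}\cdots M^{i_ni_n'}\big)_{a_0a_0',\,aa}.$$ The state is homogeneous: all one-ancilla reduced states coincide ($\varrho_1=\varrho_2=\dots$) and the two-ancilla reduced states $\varrho_{l,l+m}$ depend on $m$ only. The correlation length is finite: all eigenvalues of the transfer matrix $T=\sum_i M^{ii}$, counted with algebraic multiplicity and other than one copy of the eigenvalue $1$, have modulus less than $1$. Denote by $\{\lambda_j\}$ the distinct eigenvalues of $T$ with $|\lambda_j|<1$. Let $H$ be a Hermitian operator on ${\cal H}_S\otimes{\cal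 H}$, $U=\exp(-ig\tau H)$, and let $$\varrho_S(k\tau)={\rm tr}_{1\ldots k}\big[U_{Sk}\cdots U_{S1}(\varrho_S(0)\otimes\varrho_{1\ldots k})U_{S1}^\dagger\cdots U_{Sk}^\dagger\big]$$ be the state of the system after $k$ collisions, $U_{Sm}$ being $U$ acting on the system and the $m$-th ancilla. With $H_m$ denoting $H$ acting on the system and the $m$-th ancilla, and $\langle X\rangle_{\rm anc}$ the partial expectation of $X$ in the state of the ancillas, put, for $m\ge1$, $$K_m[\varrho]=\big[\langle H\rangle_{\rm anc},[\langle H\rangle_{\rm anc},\varrho]\big]-\big\langle[H_{m+1},[H_1,\varrho\otimes I_{\rm anc}]]\big\rangle_{\rm anc},$$ where the last average is taken in the two-ancilla state $\varrho_{1,m+1}$. **Claim.** Consider the first-order stroboscopic limit $g\tau\to0$ with $\tau>0$ and $g^2\tau=\gamma>0$ fixed. 1. For every operator $\varrho$ on ${\cal H}_S$ with $[\langle H\rangle_{\rm anc},\varrho]=0$, $$\frac{{\rm tr}_1[U(\varrho\otimes\varrho_1)U^\dagger]-\varrho}{\tau}\to L_{\rm local}[\varrho]:=g^2\tau\,{\rm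 tr}_1\big[H(\varrho\otimes\varrho_1)H-\tfrac12\{H^2,\varrho\otimes\varrho_1\}\big].$$ 2. The series $N[\varrho]=\sum_{m\ge1}K_m[\varrho]$ converges for every $\varrho$. Whenever linear maps $L^{(j)}_{\rm nonlocal}$ satisfy $K_m=\sum_j\lambda_j^m L^{(j)}_{\rm nonlocal}$ for all $m\ge1$, one has $N=\sum_j\frac{\lambda_j}{1-\lambda_j}L^{(j)}_{\rm nonlocal}$. Such maps exist if $T$ is diagonalizable and invertible. 3. For every initial density matrix $\varrho_S(0)$ the master equation $$\frac{d\varrho(t)}{dt}=L_{\rm local}[\varrho(t)]+g^2\tau\,N[\varrho(t)],\qquad \varrho(0)=\varrho_S(0),$$ that is, $\frac{d\varrho}{dt}=L_{\rm local}[\varrho]+g^2\tau\sum_j\frac{\lambda_j}{1-\lambda_j}L^{(j)}_{\rm nonlocal}[\varrho]$ for maps as in item 2, has a solution on $[0,\infty)$. Suppose that $-ig[\langle H\rangle_{\rm anc},\varrho_S(t)]$ vanishes, in at least one of the following senses: $[\langle H\rangle_{\rm anc},\varrho(t)]=0$ for all $t\ge0$ along the solution; or, for the exact states, $-ig[\langle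 H\rangle_{\rm anc},\varrho_S(\lfloor t/\tau\rfloor\tau)]\to0$ in the limit, uniformly on every interval $0\le t\le t_1$ (for instance, it is identically zero). Then the system dynamics is governed by the master equation: for every $t_1$, $\varrho_S(\lfloor t/\tau\rfloor\tau)\to\varrho(t)$ uniformly in $t\in[0,t_1]$. -/

import Mathlib

open Filter Topology
open scoped Matrix Kronecker ComplexOrder

noncomputable section

namespace Stroboscopic

variable {S A D β ι : Type*} [Fintype S] [DecidableEq S] [Fintype A] [DecidableEq A]
  [Fintype D] [DecidableEq D] [Fintype β] {n : ℕ}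

/-! ### Partial traces and reduced states -/

/-- A density matrix: positive semidefinite with unit trace. -/
def IsDensity (ρ : Matrix S S ℂ) : Prop := ρ.PosSemidef ∧ ρ.trace = 1

/-- Partial trace over the second tensor factor. -/
def ptrace (X : Matrix (S × A) (S × A) ℂ) : Matrix S S ℂ :=
  Matrix.of fun s s' => ∑ a, X (s, a) (s', a)

/-- The partial expectation `⟨X⟩_anc = tr_anc [X (1 ⊗ W)]` in the ancilla state `W`:
an operator on the system. -/
def ancMean (W : Matrix A A ℂ) (X : Matrix (S × A) (S × A) ℂ) : Matrix S S ℂ :=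
  ptrace (X * ((1 : Matrix S S ℂ) ⊗ₖ W))

/-- Reduced state of the particle number `l` in a state of `n` particles. -/
def siteState (ρ : Matrix (Fin n → A) (Fin n → A) ℂ) (l : Fin n) : Matrix A A ℂ :=
  Matrix.of fun i i' => ∑ x : Fin n → A, if x l = i then ρ x (Function.update x l i') else 0

/-- Reduced state of the particles number `l` and `m` (`l ≠ m`) in a state of `n` particles. -/
def pairState (ρ : Matrix (Fin n → A) (Fin n → A) ℂ) (l m : Fin n) :
    Matrix (A × A) (A × A) ℂ :=
  Matrix.of fun i i' => ∑ x : Fin n → A, if x l = i.1 ∧ x m = i.2 then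
    ρ x (Function.update (Function.update x l i'.1) m i'.2) else 0

/-! ### The homogeneous matrix product density operator of the ancillas -/

/-- The tensor `M^{i i'} = ∑_b B_b^i ⊗ conj (B_b^{i'})`, a matrix in the bond multiindices. -/
def mTensor (B : β → A → Matrix D D ℂ) (i i' : A) : Matrix (D × D) (D × D) ℂ :=
  ∑ b, B b i ⊗ₖ (B b i').map star

/-- The transfer matrix `T = ∑_i M^{i i}`. -/
def transfer (B : β → A → Matrix D D ℂ) : Matrix (D × D) (D × D) ℂ := ∑ i, mTensor B i i

/-- The right normalization condition `∑_{i, b} B_b^i (B_b^i)† = 1`. -/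
def RightNormalized (B : β → A → Matrix D D ℂ) : Prop :=
  ∑ b, ∑ i, B b i * (B b i)ᴴ = 1

/-- The state of the first `n` ancillas: its matrix element at `(i₁ … iₙ, i'₁ … i'ₙ)` is the
contraction of `χ₀` with `M^{i₁ i'₁} ⋯ M^{iₙ i'ₙ}`, the last pair of bond indices being traced. -/
def mpdo (B : β → A → Matrix D D ℂ) (χ₀ : Matrix D D ℂ) (n : ℕ) :
    Matrix (Fin n → A) (Fin n → A) ℂ :=
  Matrix.of fun x y => (fun p : D × D => χ₀ p.1 p.2) ⬝ᵥ
    ((List.ofFn fun l => mTensor B (x l) (y l)).prod *ᵥ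
      fun p : D × D => if p.1 = p.2 then 1 else 0)

/-- The one-ancilla state `ϱ₁`. -/
def anc1 (B : β → A → Matrix D D ℂ) (χ₀ : Matrix D D ℂ) : Matrix A A ℂ :=
  siteState (mpdo B χ₀ 1) 0

/-- The two-ancilla state `ϱ_{1, m+1}` (used for `m ≥ 1`). -/
def anc2 (B : β → A → Matrix D D ℂ) (χ₀ : Matrix D D ℂ) (m : ℕ) :
    Matrix (A × A) (A × A) ℂ :=
  pairState (mpdo B χ₀ (m + 1)) 0 (Fin.last m)

/-- Homogeneity of the correlated state: all one-ancilla reduced states coincide, and the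
two-ancilla reduced states depend only on the distance between the two ancillas. -/
def IsHomogeneous (B : β → A → Matrix D D ℂ) (χ₀ : Matrix D D ℂ) : Prop :=
  (∀ (n : ℕ) (l l' : Fin n), siteState (mpdo B χ₀ n) l = siteState (mpdo B χ₀ n) l') ∧
  (∀ (n : ℕ) (l m l' m' : Fin n), l < m → l' < m' →
    (m : ℕ) - (l : ℕ) = (m' : ℕ) - (l' : ℕ) →
    pairState (mpdo B χ₀ n) l m = pairState (mpdo B χ₀ n) l' m')

/-- Finite correlation length: all eigenvalues of the transfer matrix, counted with algebraic
multiplicity and other than one copy of the eigenvalue `1`, have modulus less than `1`. -/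
def FiniteCorrelationLength (B : β → A → Matrix D D ℂ) : Prop :=
  ∀ z ∈ (transfer B).charpoly.roots.erase 1, ‖z‖ < 1

/-- The (distinct) subleading eigenvalues of the transfer matrix. -/
def subleading (B : β → A → Matrix D D ℂ) : Finset ℂ := by
  classical exact (transfer B).charpoly.roots.toFinset.filter fun z => ‖z‖ < 1

/-! ### The collision model -/

/-- The elementary unitary operator `U = exp (-i g τ H)`. -/
def collisionU (H : Matrix (S × A) (S × A) ℂ) (g τ : ℝ) : Matrix (S × A) (S × A) ℂ :=
  NormedSpace.exp ((-(Complex.I * ((g * τ : ℝ) : ℂ))) • H)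

/-- The operator `X` acting on the system and on the ancilla number `m` out of `n`. -/
def actOn (X : Matrix (S × A) (S × A) ℂ) (m : Fin n) :
    Matrix (S × (Fin n → A)) (S × (Fin n → A)) ℂ :=
  Matrix.of fun x y => if ∀ l, l ≠ m → x.2 l = y.2 l then
    X (x.1, x.2 m) (y.1, y.2 m) else 0

/-- The product `U_{Sn} ⋯ U_{S2} U_{S1}`: the system collides with the ancillas in order. -/
def collisions (U : Matrix (S × A) (S × A) ℂ) (n : ℕ) :
    Matrix (S × (Fin n → A)) (S × (Fin n → A)) ℂ :=
  (List.ofFn fun m : Fin n => actOn U m).reverse.prod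

/-- The exact state `ϱ_S(kτ)` of the system after `k` collisions with the correlated ancillas. -/
def systemState (B : β → A → Matrix D D ℂ) (χ₀ : Matrix D D ℂ)
    (H : Matrix (S × A) (S × A) ℂ) (g τ : ℝ) (ρ₀ : Matrix S S ℂ) (k : ℕ) : Matrix S S ℂ :=
  ptrace (collisions (collisionU H g τ) k * (ρ₀ ⊗ₖ mpdo B χ₀ k) *
    (collisions (collisionU H g τ) k)ᴴ)

/-! ### Generators -/

/-- `⟨H⟩_anc`. -/
def meanH (B : β → A → Matrix D D ℂ) (χ₀ : Matrix D D ℂ)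
    (H : Matrix (S × A) (S × A) ℂ) : Matrix S S ℂ :=
  ancMean (anc1 B χ₀) H

/-- The increment rate `(tr₁ [U (ϱ ⊗ ϱ₁) U†] - ϱ) / τ` caused by a single collision. -/
def localIncrement (B : β → A → Matrix D D ℂ) (χ₀ : Matrix D D ℂ)
    (H : Matrix (S × A) (S × A) ℂ) (g τ : ℝ) (ρ : Matrix S S ℂ) : Matrix S S ℂ :=
  ((τ⁻¹ : ℝ) : ℂ) • (ptrace (collisionU H g τ * (ρ ⊗ₖ anc1 B χ₀) * (collisionU H g τ)ᴴ) - ρ)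

/-- `L_local [ϱ] = γ tr₁ [H (ϱ ⊗ ϱ₁) H - {H², ϱ ⊗ ϱ₁} / 2]`, where `γ = g² τ`. -/
def localGen (B : β → A → Matrix D D ℂ) (χ₀ : Matrix D D ℂ)
    (H : Matrix (S × A) (S × A) ℂ) (γ : ℝ) (ρ : Matrix S S ℂ) : Matrix S S ℂ :=
  (γ : ℂ) • ptrace (H * (ρ ⊗ₖ anc1 B χ₀) * H -
    (1 / 2 : ℂ) • (H * H * (ρ ⊗ₖ anc1 B χ₀) + (ρ ⊗ₖ anc1 B χ₀) * (H * H)))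

/-- The operator `H` coupling the system to the first of two ancillas. -/
def onFst (H : Matrix (S × A) (S × A) ℂ) : Matrix (S × (A × A)) (S × (A × A)) ℂ :=
  Matrix.of fun x y => if x.2.2 = y.2.2 then H (x.1, x.2.1) (y.1, y.2.1) else 0

/-- The operator `H` coupling the system to the second of two ancillas. -/
def onSnd (H : Matrix (S × A) (S × A) ℂ) : Matrix (S × (A × A)) (S × (A × A)) ℂ :=
  Matrix.of fun x y => if x.2.1 = y.2.1 then H (x.1, x.2.2) (y.1, y.2.2) else 0

/-- The memory kernel
`K_m [ϱ] = [⟨H⟩, [⟨H⟩, ϱ]] - ⟨[H_{m+1}, [H_1, ϱ ⊗ 1]]⟩`, `m ≥ 1`. -/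
def kernel (B : β → A → Matrix D D ℂ) (χ₀ : Matrix D D ℂ)
    (H : Matrix (S × A) (S × A) ℂ) (m : ℕ) (ρ : Matrix S S ℂ) : Matrix S S ℂ :=
  ⁅meanH B χ₀ H, ⁅meanH B χ₀ H, ρ⁆⁆ -
    ancMean (anc2 B χ₀ m) ⁅onSnd H, ⁅onFst H, ρ ⊗ₖ (1 : Matrix (A × A) (A × A) ℂ)⁆⁆

/-- The maps `L^{(j)}`, indexed by the subleading eigenvalues `λ_j` of the transfer matrix, give
the expansion `K_m = ∑_j λ_j ^ m L^{(j)}` of the kernel for all `m ≥ 1`. -/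
def IsKernelExpansion (B : β → A → Matrix D D ℂ) (χ₀ : Matrix D D ℂ)
    (H : Matrix (S × A) (S × A) ℂ) (L : ℂ → Matrix S S ℂ →ₗ[ℂ] Matrix S S ℂ) : Prop :=
  ∀ m : ℕ, 1 ≤ m → ∀ ρ : Matrix S S ℂ,
    kernel B χ₀ H m ρ = ∑ z ∈ subleading B, z ^ m • L z ρ

/-- `r` solves the master equation `dr/dt = G [r]` on `[0, ∞)` with `r 0 = ρ₀`. -/
def IsSolution (G : Matrix S S ℂ → Matrix S S ℂ) (ρ₀ : Matrix S S ℂ) (r : ℝ → Matrix S S ℂ) :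
    Prop :=
  r 0 = ρ₀ ∧ ∀ t : ℝ, 0 ≤ t → HasDerivWithinAt r (G (r t)) (Set.Ici 0) t

end Stroboscopic

end

/-! Put ε = gτ and let the system carry the bond of the tensor network along. One collision then
acts on families Z : D × D → Matrix S S ℂ by a single linear map E(ε), an instance of `stepMap`, and
ϱ_S(kτ) is the bond contraction W = `bondTrace` of the k-th iterate started from χ₀ and ϱ_S(0)
(`systemState_eq_iterate`). The correlated model has become a memoryless one on a larger space, with
E(ε) = E₀ + εE₁ + ε²E₂ + O(ε³).

E₀ is the transfer matrix acting on the bond alone. Its eigenvalue 1 is simple and the others lie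
inside the unit disc, so E₀^m tends summably to JW, where J = `bondProd w` attaches the stationary
bond row w (`exists_summable_pow_sub_vecMulVec`). The bond relaxes at a rate fixed per collision,
while times of order one take about ε⁻² collisions: this is an averaging problem. With R = ∑ (E₀^m -
JW), A = W E₁ J and W₁ = (W E₁ - A W) R, the effective generators are A at order ε and C = W E₂ J +
W₁ E₁ J at order ε².

By homogeneity the one- and two-ancilla states can be read off arbitrarily deep in the chain, where
the bond has relaxed from χ₀ to w (`anc1_eq`, `anc2_eq`). Hence A = -i[⟨H⟩, ·], γ W E₂ J = L_local
and K_{m+1} = W E₁ (E₀^m - JW) E₁ J (`kernel_succ_eq`); the memory term of C is therefore ∑ K_m.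

For convergence, the observable is corrected instead of the state: W + εW₁ + ε²W₂ obeys a step
equation closed up to O(ε³), and about ε⁻² such errors add up to O(ε) by a discrete Gronwall
inequality (`tendstoUniformlyOn_of_effective_generator`). The iterates stay bounded because E(ε) is
completely positive and trace preserving. The dangerous term is εA. If A kills the solution, εA acts
on the error only, and 1 + εA has operator norm 1 + O(ε²) because A is a commutator with a Hermitian
matrix (`norm_add_smul_commutator_le`). If gA vanishes asymptotically on the exact states, εA = τ·gA
is an o(τ) perturbation per step. -/

noncomputable section

set_option linter.unusedSectionVars false

namespace Stroboscopic

/-! ### Discrete Gronwall inequality and comparison of a perturbed Euler scheme with a linear flow.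
-/

section Gronwall

theorem discrete_gronwall {d : ℕ → ℝ} {a e : ℝ} {n : ℕ} (ha : 0 ≤ a) (he : 0 ≤ e)
    (hd : ∀ k < n, d (k + 1) ≤ (1 + a) * d k + e) (h0 : 0 ≤ d 0) :
    ∀ k ≤ n, d k ≤ Real.exp (a * k) * (d 0 + k * e) := by
  intro k
  induction k with
  | zero => intro _; simp
  | succ k ih =>
    intro hk
    have h1 := ih (by omega)
    have h2 := hd k (by omega)
    have h3 : 1 + a ≤ Real.exp a := by linarith [Real.add_one_le_exp a]
    have h4 : (1 : ℝ) ≤ Real.exp (a * (k + 1 : ℕ)) := Real.one_le_exp (by positivity)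
    have h5 : Real.exp (a * (k + 1 : ℕ)) = Real.exp a * Real.exp (a * k) := by
      rw [← Real.exp_add]; push_cast; ring_nf
    have h6 : (0 : ℝ) ≤ d 0 + k * e := by positivity
    calc d (k + 1) ≤ (1 + a) * (Real.exp (a * k) * (d 0 + k * e)) + e := by
          have := mul_le_mul_of_nonneg_left h1 (by positivity : 0 ≤ 1 + a)
          linarith
      _ ≤ Real.exp a * (Real.exp (a * k) * (d 0 + k * e)) +
            Real.exp (a * (k + 1 : ℕ)) * e := by
          gcongr
          nlinarith
      _ = Real.exp (a * (k + 1 : ℕ)) * (d 0 + (k + 1 : ℕ) * e) := by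
          rw [h5]; push_cast; ring

variable {M : Type*} [NormedAddCommGroup M]

/-- The solution is bounded on the compact interval, which gives the Lipschitz bound. The mean value
inequality applied to x ↦ r x - (x - t) G (r t) then gives the quadratic local error of the Euler
step. -/
theorem lipschitz_and_euler_of_linear_ode [NormedSpace ℝ M] (G : M →L[ℝ] M) {r : ℝ → M}
    (hr : ∀ t : ℝ, 0 ≤ t → HasDerivWithinAt r (G (r t)) (Set.Ici 0) t) (t₁ : ℝ) :
    ∃ K : ℝ, 0 ≤ K ∧ ∀ t s : ℝ, 0 ≤ t → t ≤ s → s ≤ t₁ →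
      ‖r s - r t‖ ≤ K * (s - t) ∧ ‖r s - r t - (s - t) • G (r t)‖ ≤ K * (s - t) ^ 2 := by
  have hcont : ContinuousOn r (Set.Icc 0 t₁) := fun t ht =>
    ((hr t ht.1).continuousWithinAt).mono Set.Icc_subset_Ici_self
  obtain ⟨R, hR⟩ := (isCompact_Icc (a := (0 : ℝ)) (b := t₁)).exists_bound_of_continuousOn hcont
  have hRR : ∀ t ∈ Set.Icc (0 : ℝ) t₁, ‖G (r t)‖ ≤ ‖G‖ * |R| := fun t ht =>
    (G.le_opNorm _).trans (by gcongr; exact (hR t ht).trans (le_abs_self R))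
  have hlip : ∀ t s : ℝ, 0 ≤ t → t ≤ s → s ≤ t₁ → ‖r s - r t‖ ≤ ‖G‖ * |R| * (s - t) := by
    intro t s ht hts hs
    have := Convex.norm_image_sub_le_of_norm_hasDerivWithin_le (f := r) (f' := fun t => G (r t))
      (s := Set.Icc 0 t₁) (x := t) (y := s) (C := ‖G‖ * |R|)
      (fun x hx => (hr x hx.1).mono Set.Icc_subset_Ici_self) hRR (convex_Icc _ _)
      ⟨ht, hts.trans hs⟩ ⟨ht.trans hts, hs⟩
    rwa [Real.norm_of_nonneg (by linarith)] at this
  refine ⟨max (‖G‖ * |R|) (‖G‖ * (‖G‖ * |R|)), by positivity, fun t s ht hts hs => ⟨?_, ?_⟩⟩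
  · refine (hlip t s ht hts hs).trans ?_
    exact mul_le_mul_of_nonneg_right (le_max_left _ _) (by linarith)
  · have hd : ∀ x ∈ Set.Icc t s, HasDerivWithinAt (fun x => r x - (x - t) • G (r t))
        (G (r x) - G (r t)) (Set.Icc t s) x := by
      intro x hx
      have h1 := (hr x (ht.trans hx.1)).mono
        (Set.Icc_subset_Ici_self.trans (Set.Ici_subset_Ici.2 ht) : Set.Icc t s ⊆ Set.Ici 0)
      have h2 : HasDerivWithinAt (fun x : ℝ => (x - t) • G (r t)) ((1 : ℝ) • G (r t))
          (Set.Icc t s) x := (((hasDerivWithinAt_id x _).sub_const t).smul_const (G (r t)))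
      rw [one_smul] at h2
      exact h1.sub h2
    have hb : ∀ x ∈ Set.Icc t s, ‖G (r x) - G (r t)‖ ≤ ‖G‖ * (‖G‖ * |R|) * (s - t) := by
      intro x hx
      rw [← map_sub]
      refine (G.le_opNorm _).trans ?_
      rw [mul_assoc]
      gcongr
      refine (hlip t x ht hx.1 (hx.2.trans hs)).trans ?_
      gcongr
      exact hx.2
    have := Convex.norm_image_sub_le_of_norm_hasDerivWithin_le hd hb (convex_Icc _ _)
      (Set.left_mem_Icc.2 hts) (Set.right_mem_Icc.2 hts)
    rw [Real.norm_of_nonneg (by linarith)] at this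
    simp only [sub_self, zero_smul, sub_zero] at this
    calc ‖r s - r t - (s - t) • G (r t)‖ = ‖r s - (s - t) • G (r t) - r t‖ := by
          congr 1; abel
      _ ≤ ‖G‖ * (‖G‖ * |R|) * (s - t) * (s - t) := this
      _ ≤ _ := by
          rw [mul_assoc, ← sq]
          gcongr
          exact le_max_right _ _

/-- The auxiliary sequence s shadows ρ uniformly in k and is the one that satisfies a good
recursion. Its initial value need not equal r 0, only be close to it. -/
theorem tendstoUniformlyOn_floor_of_step {ι : Type*} {l : Filter ι} {τ : ι → ℝ}
    (hτ : ∀ n, 0 < τ n) (hτ0 : Tendsto τ l (𝓝 0)) {r : ℝ → M} {ρ s : ι → ℕ → M} {a t₁ K : ℝ}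
    (ha : 0 ≤ a)
    (hlip : ∀ t s : ℝ, 0 ≤ t → t ≤ s → s ≤ t₁ → ‖r s - r t‖ ≤ K * (s - t)) (hK : 0 ≤ K)
    (h0 : ∀ n, ρ n 0 = r 0)
    (hs : ∀ η > 0, ∀ᶠ n in l, ∀ k, ‖s n k - ρ n k‖ ≤ η)
    (hstep : ∀ η > 0, ∀ᶠ n in l, ∀ k : ℕ, (k + 1) * τ n ≤ t₁ →
      ‖s n (k + 1) - r ((k + 1) * τ n)‖ ≤ (1 + a * τ n) * ‖s n k - r (k * τ n)‖ + η * τ n) :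
    TendstoUniformlyOn (fun n t => ρ n ⌊t / τ n⌋₊) r l (Set.Icc 0 t₁) := by
  rw [Metric.tendstoUniformlyOn_iff]
  intro δ hδ
  obtain ht₁ | ht₁ := lt_or_ge t₁ 0
  · exact Eventually.of_forall fun n x hx => absurd (hx.1.trans hx.2) (by linarith)
  -- The three summands pay for the accumulated Gronwall error, for the distance between s and ρ,
  -- and for the motion of r within one time step.
  set c := Real.exp (a * t₁) * (1 + t₁) + 1 + K with hc
  have hcpos : 0 < c := by positivity
  set η := δ / (2 * c) with hη
  have hηpos : 0 < η := by positivity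
  have hτη : ∀ᶠ n in l, τ n < η := hτ0.eventually (gt_mem_nhds hηpos)
  filter_upwards [hs η hηpos, hstep η hηpos, hτη] with n h1 h2 h3 t ht
  set k := ⌊t / τ n⌋₊ with hk
  have hτn := hτ n
  have hkt : k * τ n ≤ t := by
    have := Nat.floor_le (div_nonneg ht.1 hτn.le)
    rwa [le_div_iff₀ hτn] at this
  have htk : t - k * τ n ≤ τ n := by
    have := (Nat.lt_floor_add_one (t / τ n)).le
    rw [div_le_iff₀ hτn] at this
    rw [hk]; linarith
  have hg := discrete_gronwall (d := fun k => ‖s n k - r (k * τ n)‖) (a := a * τ n) (e := η * τ n)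
    (n := k) (by positivity) (by positivity) (fun j hj => by
      have hj' : ((j : ℝ) + 1) * τ n ≤ t₁ := by
        have : ((j : ℝ) + 1) ≤ k := by exact_mod_cast hj
        exact (mul_le_mul_of_nonneg_right this hτn.le).trans (hkt.trans ht.2)
      have := h2 j hj'
      push_cast
      exact this) (norm_nonneg _) k le_rfl
  simp only [Nat.cast_zero, zero_mul] at hg
  have hd0 : ‖s n 0 - r 0‖ ≤ η := by rw [← h0 n]; exact h1 0
  have hkt₁ : k * τ n ≤ t₁ := hkt.trans ht.2
  have hdk : ‖s n k - r (k * τ n)‖ ≤ Real.exp (a * t₁) * (1 + t₁) * η := by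
    refine hg.trans ?_
    have e1 : Real.exp (a * τ n * k) ≤ Real.exp (a * t₁) := by
      apply Real.exp_le_exp.2
      calc a * τ n * k = a * (k * τ n) := by ring
        _ ≤ _ := by gcongr
    have e2 : ‖s n 0 - r 0‖ + k * (η * τ n) ≤ (1 + t₁) * η :=
      calc ‖s n 0 - r 0‖ + k * (η * τ n) ≤ η + η * (k * τ n) := by linarith
        _ ≤ η + η * t₁ := by gcongr
        _ = _ := by ring
    calc _ ≤ Real.exp (a * t₁) * ((1 + t₁) * η) := by gcongr
      _ = _ := by ring
  have hl := hlip (k * τ n) t (by positivity) hkt ht.2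
  have hl' : ‖r t - r (k * τ n)‖ ≤ K * η := hl.trans (by gcongr; linarith)
  rw [dist_eq_norm]
  calc ‖r t - ρ n k‖ = ‖(r t - r (k * τ n)) - (s n k - r (k * τ n)) + (s n k - ρ n k)‖ := by
        congr 1; abel
    _ ≤ ‖r t - r (k * τ n)‖ + ‖s n k - r (k * τ n)‖ + ‖s n k - ρ n k‖ :=
        (norm_add_le _ _).trans (add_le_add_left (norm_sub_le _ _) _)
    _ ≤ K * η + Real.exp (a * t₁) * (1 + t₁) * η + η := by gcongr; exact h1 k
    _ = c * η := by rw [hc]; ring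
    _ = δ / 2 := by rw [hη]; field_simp
    _ < δ := by linarith

end Gronwall

/-! ### Perturbation theory around E₀: reduced resolvent, correctors and effective generators. -/

section Corrector

variable {V M : Type*} [NormedAddCommGroup V] [NormedSpace ℂ V]
  [NormedAddCommGroup M] [NormedSpace ℂ M]
  (E₀ E₁ E₂ : V →L[ℂ] V) (W : V →L[ℂ] M) (J : M →L[ℂ] V)

/-- The reduced resolvent `∑ (E₀ ^ m - J W)` of `E₀` at the eigenvalue `1`. -/
def reducedResolvent : V →L[ℂ] V := ∑' m : ℕ, (E₀ ^ m - J ∘L W)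

/-- The first-order effective generator. -/
def effGen₁ : M →L[ℂ] M := W ∘L E₁ ∘L J

/-- The first-order corrector. -/
def corrector₁ : V →L[ℂ] M := (W ∘L E₁ - effGen₁ E₁ W J ∘L W) ∘L reducedResolvent E₀ W J

/-- The memory contribution to the second-order effective generator. -/
def effMemory : M →L[ℂ] M := corrector₁ E₀ E₁ W J ∘L E₁ ∘L J

/-- The second-order effective generator. -/
def effGen₂ : M →L[ℂ] M := W ∘L E₂ ∘L J + effMemory E₀ E₁ W J

variable {E₀ E₁ E₂ W J}

theorem comp_pow_of_comp_eq (hW : W ∘L E₀ = W) (m : ℕ) : W ∘L E₀ ^ m = W := by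
  induction m with
  | zero => ext; simp
  | succ m ih => rw [pow_succ, ContinuousLinearMap.mul_def, ← ContinuousLinearMap.comp_assoc, ih, hW]

theorem pow_comp_of_comp_eq (hJ : E₀ ∘L J = J) (m : ℕ) : (E₀ ^ m) ∘L J = J := by
  induction m with
  | zero => ext; simp
  | succ m ih => rw [pow_succ, ContinuousLinearMap.mul_def, ContinuousLinearMap.comp_assoc, hJ, ih]

/-- Since W E₀ = W, the series multiplied by 1 - E₀ telescopes to 1 - lim E₀^m. Consequently X (1 -
E₀) = F is solved by X = F R whenever F J = 0. -/
theorem reducedResolvent_comp_one_sub [CompleteSpace V] (hW : W ∘L E₀ = W)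
    (hsum : Summable fun m : ℕ => E₀ ^ m - J ∘L W) :
    reducedResolvent E₀ W J ∘L (1 - E₀) = 1 - J ∘L W := by
  have h1 : HasSum (fun m : ℕ => (E₀ ^ m - J ∘L W) * (1 - E₀))
      (reducedResolvent E₀ W J * (1 - E₀)) := hsum.hasSum.mul_right _
  have h2 : ∀ m : ℕ, (E₀ ^ m - J ∘L W) * (1 - E₀) = E₀ ^ m - E₀ ^ (m + 1) := by
    intro m
    have : (J ∘L W) * E₀ = J ∘L W := by
      rw [ContinuousLinearMap.mul_def, ContinuousLinearMap.comp_assoc, hW]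
    rw [sub_mul, mul_sub, mul_sub, this, pow_succ]
    simp
  simp_rw [h2] at h1
  have h3 := h1.tendsto_sum_nat
  simp_rw [Finset.sum_range_sub'] at h3
  have h4 : Tendsto (fun m : ℕ => E₀ ^ m) atTop (𝓝 (J ∘L W)) := by
    simpa using hsum.tendsto_atTop_zero.add_const (J ∘L W)
  have h5 := (tendsto_const_nhds (x := E₀ ^ 0)).sub h4
  rw [pow_zero] at h3 h5
  exact tendsto_nhds_unique h3 h5

theorem reducedResolvent_comp [CompleteSpace V] (hWJ : W ∘L J = 1) (hJ : E₀ ∘L J = J)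
    (hsum : Summable fun m : ℕ => E₀ ^ m - J ∘L W) :
    reducedResolvent E₀ W J ∘L J = 0 := by
  ext x
  have h1 := hsum.hasSum.mapL (ContinuousLinearMap.apply ℂ V (J x))
  have h2 : ∀ m : ℕ, (ContinuousLinearMap.apply ℂ V (J x)) (E₀ ^ m - J ∘L W) = 0 := by
    intro m
    have e1 := congrArg (fun F => F x) (pow_comp_of_comp_eq hJ m)
    have e2 := congrArg (fun F => F x) hWJ
    simp only [ContinuousLinearMap.comp_apply, one_apply_eq_self] at e1 e2
    simp [e1, e2]
  simp_rw [h2] at h1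
  exact h1.unique hasSum_zero

/-- The equation W₁ (1 - E₀) = W E₁ - A W is solvable because A = W E₁ J makes its right-hand side
vanish on the range of J. -/
theorem corrector₁_equation [CompleteSpace V] (hWJ : W ∘L J = 1) (hW : W ∘L E₀ = W)
    (hsum : Summable fun m : ℕ => E₀ ^ m - J ∘L W) :
    W ∘L E₁ + corrector₁ E₀ E₁ W J ∘L E₀ =
      corrector₁ E₀ E₁ W J + effGen₁ E₁ W J ∘L W := by
  have h1 : corrector₁ E₀ E₁ W J ∘L (1 - E₀) = W ∘L E₁ - effGen₁ E₁ W J ∘L W := by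
    rw [corrector₁, ContinuousLinearMap.comp_assoc, reducedResolvent_comp_one_sub hW hsum]
    ext x
    have e2 := fun y => congrArg (fun F => F y) hWJ
    simp only [ContinuousLinearMap.comp_apply, one_apply_eq_self] at e2
    simp [effGen₁, e2]
  ext x
  have := congrArg (fun F => F x) h1
  simp at this ⊢
  linear_combination (norm := module) -this

theorem corrector₁_comp [CompleteSpace V] (hWJ : W ∘L J = 1) (hJ : E₀ ∘L J = J)
    (hsum : Summable fun m : ℕ => E₀ ^ m - J ∘L W) : corrector₁ E₀ E₁ W J ∘L J = 0 := by
  rw [corrector₁, ContinuousLinearMap.comp_assoc, reducedResolvent_comp hWJ hJ hsum]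
  simp

/-- The part A W of `corrector₁` contributes nothing, as W (E₀^m - JW) = 0. -/
theorem hasSum_effMemory [CompleteSpace V] (hW : W ∘L E₀ = W)
    (hsum : Summable fun m : ℕ => E₀ ^ m - J ∘L W) (hWJ : W ∘L J = 1) (x : M) :
    HasSum (fun m : ℕ => W (E₁ ((E₀ ^ m - J ∘L W) (E₁ (J x))))) (effMemory E₀ E₁ W J x) := by
  have h1 := (hsum.hasSum.mapL (ContinuousLinearMap.apply ℂ V (E₁ (J x)))).mapL
    (W ∘L E₁ - effGen₁ E₁ W J ∘L W)
  refine HasSum.congr_fun ?_ (fun m => ?_) (f := fun m : ℕ => (W ∘L E₁ - effGen₁ E₁ W J ∘L W)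
    (ContinuousLinearMap.apply ℂ V (E₁ (J x)) (E₀ ^ m - J ∘L W)))
  · exact h1
  have e1 := congrArg (fun F => F (E₁ (J x))) (comp_pow_of_comp_eq hW m)
  have e2 := congrArg (fun F => F (W (E₁ (J x)))) hWJ
  simp only [ContinuousLinearMap.comp_apply, one_apply_eq_self] at e1 e2
  generalize E₀ ^ m = P at e1 ⊢
  simp [e1, e2]

/-- The choice of C is exactly the solvability condition at order ε². The map `A` stays free because
W₁ J = 0; the two alternatives of the convergence theorem use different values of it. -/
theorem exists_corrector₂ [CompleteSpace V] (hWJ : W ∘L J = 1) (hW : W ∘L E₀ = W) (hJ : E₀ ∘L J = J)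
    (hsum : Summable fun m : ℕ => E₀ ^ m - J ∘L W) (A : M →L[ℂ] M) :
    ∃ W₂ : V →L[ℂ] M, W ∘L E₂ + corrector₁ E₀ E₁ W J ∘L E₁ + W₂ ∘L E₀ =
      W₂ + A ∘L corrector₁ E₀ E₁ W J + effGen₂ E₀ E₁ E₂ W J ∘L W := by
  set F := W ∘L E₂ + corrector₁ E₀ E₁ W J ∘L E₁ - A ∘L corrector₁ E₀ E₁ W J -
    effGen₂ E₀ E₁ E₂ W J ∘L W with hF
  have hFJ : F ∘L J = 0 := by
    ext x
    have e1 := congrArg (fun F => F x) (corrector₁_comp (E₁ := E₁) hWJ hJ hsum)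
    have e2 := congrArg (fun F => F x) hWJ
    simp only [ContinuousLinearMap.comp_apply, one_apply_eq_self] at e1 e2
    simp [hF, effGen₂, effMemory, e1, e2]
  refine ⟨F ∘L reducedResolvent E₀ W J, ?_⟩
  have h1 : (F ∘L reducedResolvent E₀ W J) ∘L (1 - E₀) = F := by
    rw [ContinuousLinearMap.comp_assoc, reducedResolvent_comp_one_sub hW hsum]
    ext x
    have e2 := fun y => congrArg (fun F => F y) hFJ
    simp only [ContinuousLinearMap.comp_apply] at e2
    simp [e2]
  ext x
  have h2 := congrArg (fun F => F x) h1
  simp [hF] at h2 ⊢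
  linear_combination (norm := module) -h2

/-- The observable `W` corrected to second order. -/
def correctedObs (W W₁ W₂ : V →L[ℂ] M) (ε : ℝ) : V →L[ℂ] M :=
  W + (ε : ℂ) • W₁ + (ε : ℂ) ^ 2 • W₂

theorem norm_correctedObs_sub_le (W W₁ W₂ : V →L[ℂ] M) {ε : ℝ} (hε : |ε| ≤ 1) (Z : V) :
    ‖correctedObs W W₁ W₂ ε Z - W Z‖ ≤ (‖W₁‖ + ‖W₂‖) * |ε| * ‖Z‖ := by
  have h1 : correctedObs W W₁ W₂ ε Z - W Z = (ε : ℂ) • W₁ Z + (ε : ℂ) ^ 2 • W₂ Z := by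
    simp [correctedObs]; abel
  have h2 : |ε| ^ 2 ≤ |ε| := by nlinarith [abs_nonneg ε]
  rw [h1]
  refine (norm_add_le _ _).trans ?_
  rw [norm_smul, norm_smul, norm_pow, Complex.norm_real, Real.norm_eq_abs]
  calc |ε| * ‖W₁ Z‖ + |ε| ^ 2 * ‖W₂ Z‖ ≤ |ε| * (‖W₁‖ * ‖Z‖) + |ε| * (‖W₂‖ * ‖Z‖) := by
        gcongr <;> exact ContinuousLinearMap.le_opNorm _ _
    _ = _ := by ring

/-- The hypotheses are the matching conditions at orders 1, ε and ε², so only terms of order ε³ and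
higher survive. -/
theorem norm_correctedObs_step_le {W₁ W₂ : V →L[ℂ] M} {A A' C : M →L[ℂ] M}
    (hW : W ∘L E₀ = W) (h₁ : W ∘L E₁ + W₁ ∘L E₀ = W₁ + A ∘L W)
    (h₂ : W ∘L E₂ + W₁ ∘L E₁ + W₂ ∘L E₀ = W₂ + A' ∘L W₁ + C ∘L W) {c : ℝ} (hc : 0 ≤ c) :
    ∃ K : ℝ, 0 ≤ K ∧ ∀ (ε : ℝ) (E : V →L[ℂ] V), |ε| ≤ 1 →
      ‖E - (E₀ + (ε : ℂ) • E₁ + (ε : ℂ) ^ 2 • E₂)‖ ≤ c * |ε| ^ 3 → ∀ Z : V,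
      ‖correctedObs W W₁ W₂ ε (E Z) - (correctedObs W W₁ W₂ ε Z + (ε : ℂ) • A (W Z) +
        (ε : ℂ) ^ 2 • A' (W₁ Z) + (ε : ℂ) ^ 2 • C (W Z))‖ ≤ K * |ε| ^ 3 * ‖Z‖ := by
  refine ⟨‖W₁ ∘L E₂ + W₂ ∘L E₁‖ + ‖W₂ ∘L E₂‖ + (‖W‖ + (‖W₁‖ + ‖W₂‖)) * c, by positivity, ?_⟩
  intro ε E hε hE Z
  set R := E - (E₀ + (ε : ℂ) • E₁ + (ε : ℂ) ^ 2 • E₂) with hR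
  have hEZ : E Z = E₀ Z + (ε : ℂ) • E₁ Z + (ε : ℂ) ^ 2 • E₂ Z + R Z := by
    simp [hR]
  have a0 := congrArg (fun F => F Z) hW
  have a1 := congrArg (fun F => F Z) h₁
  have a2 := congrArg (fun F => F Z) h₂
  simp only [ContinuousLinearMap.comp_apply, add_apply] at a0 a1 a2
  have key : correctedObs W W₁ W₂ ε (E Z) - (correctedObs W W₁ W₂ ε Z + (ε : ℂ) • A (W Z) +
        (ε : ℂ) ^ 2 • A' (W₁ Z) + (ε : ℂ) ^ 2 • C (W Z)) =
      (ε : ℂ) ^ 3 • (W₁ ∘L E₂ + W₂ ∘L E₁) Z + (ε : ℂ) ^ 4 • (W₂ ∘L E₂) Z +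
        correctedObs W W₁ W₂ ε (R Z) := by
    rw [hEZ]
    simp only [correctedObs, add_apply, smul_apply,
      map_add, map_smul, ContinuousLinearMap.comp_apply, smul_add, smul_smul]
    linear_combination (norm := module) a0 + (ε : ℂ) • a1 + (ε : ℂ) ^ 2 • a2
  have hRZ : ‖R Z‖ ≤ c * |ε| ^ 3 * ‖Z‖ := (R.le_opNorm Z).trans (by gcongr)
  have hobs : ‖correctedObs W W₁ W₂ ε (R Z)‖ ≤ (‖W‖ + (‖W₁‖ + ‖W₂‖)) * ‖R Z‖ := by
    have e1 := norm_correctedObs_sub_le W W₁ W₂ hε (R Z)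
    have e2 := W.le_opNorm (R Z)
    have e3 := norm_add_le (correctedObs W W₁ W₂ ε (R Z) - W (R Z)) (W (R Z))
    rw [sub_add_cancel] at e3
    have e4 : (‖W₁‖ + ‖W₂‖) * |ε| * ‖R Z‖ ≤ (‖W₁‖ + ‖W₂‖) * 1 * ‖R Z‖ := by gcongr
    linarith
  have h34 : |ε| ^ 4 ≤ |ε| ^ 3 := pow_le_pow_of_le_one (abs_nonneg _) hε (by norm_num)
  rw [key]
  refine (norm_add₃_le).trans ?_
  rw [norm_smul, norm_smul, norm_pow, norm_pow, Complex.norm_real, Real.norm_eq_abs]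
  calc _ ≤ |ε| ^ 3 * (‖W₁ ∘L E₂ + W₂ ∘L E₁‖ * ‖Z‖) + |ε| ^ 3 * (‖W₂ ∘L E₂‖ * ‖Z‖) +
        (‖W‖ + (‖W₁‖ + ‖W₂‖)) * (c * |ε| ^ 3 * ‖Z‖) := by
        gcongr
        · exact ContinuousLinearMap.le_opNorm _ _
        · exact ContinuousLinearMap.le_opNorm _ _
        · exact hobs.trans (by gcongr)
    _ = _ := by ring

end Corrector

/-! ### Abstract convergence theorem for the slow variable. -/

section Convergence

variable {V M : Type*} [NormedAddCommGroup V] [NormedSpace ℂ V] [CompleteSpace V]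
  [NormedAddCommGroup M] [NormedSpace ℂ M] [NormedSpace ℝ M] [IsScalarTower ℝ ℂ M]

theorem tendstoUniformlyOn_of_effective_generator
    {E₀ E₁ E₂ : V →L[ℂ] V} {W : V →L[ℂ] M} {J : M →L[ℂ] V}
    (hWJ : W ∘L J = 1) (hW : W ∘L E₀ = W) (hJ : E₀ ∘L J = J)
    (hsum : Summable fun m : ℕ => E₀ ^ m - J ∘L W)
    {E : ℝ → V →L[ℂ] V} {c : ℝ} (hc : 0 ≤ c)
    (hE : ∀ᶠ ε in 𝓝 (0 : ℝ), ‖E ε - (E₀ + (ε : ℂ) • E₁ + (ε : ℂ) ^ 2 • E₂)‖ ≤ c * |ε| ^ 3)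
    {b : ℝ} (hb : 0 ≤ b) (hstab : ∀ (ε : ℝ) (X : M),
      ‖X + (ε : ℂ) • effGen₁ E₁ W J X‖ ≤ (1 + b * ε ^ 2) * ‖X‖)
    {ι : Type*} {l : Filter ι} {γ : ℝ} (hγ : 0 < γ) {g τ : ι → ℝ} (hτ : ∀ n, 0 < τ n)
    (hgγ : ∀ n, g n ^ 2 * τ n = γ) (hlim : Tendsto (fun n => g n * τ n) l (𝓝 0))
    {Φ : ι → ℕ → V} {R : ℝ} (hR : ∀ n k, ‖Φ n k‖ ≤ R)
    (hΦ : ∀ n k, Φ n (k + 1) = E (g n * τ n) (Φ n k))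
    {r : ℝ → M} (hr₀ : ∀ n, W (Φ n 0) = r 0)
    (hr : ∀ t : ℝ, 0 ≤ t →
      HasDerivWithinAt r ((γ : ℂ) • effGen₂ E₀ E₁ E₂ W J (r t)) (Set.Ici 0) t)
    (hvanish : (∀ t : ℝ, 0 ≤ t → effGen₁ E₁ W J (r t) = 0) ∨
      ∀ t₁ : ℝ, TendstoUniformlyOn (fun n t => (g n : ℂ) • effGen₁ E₁ W J (W (Φ n ⌊t / τ n⌋₊)))
        (fun _ => 0) l (Set.Icc 0 t₁)) (t₁ : ℝ) :
    TendstoUniformlyOn (fun n t => W (Φ n ⌊t / τ n⌋₊)) r l (Set.Icc 0 t₁) := by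
  -- This is the scaling of the limit: order ε² is order τ, so an O(ε³) error per collision is o(τ).
  have hε2 : ∀ n, (g n * τ n) ^ 2 = γ * τ n := fun n => by rw [← hgγ n]; ring
  have hτ0 : Tendsto τ l (𝓝 0) := by
    have h1 : ∀ n, τ n = (g n * τ n) ^ 2 / γ := fun n => by rw [hε2]; field_simp
    have h2 := (hlim.pow 2).div_const γ
    simp only [ne_eq, OfNat.ofNat_ne_zero, not_false_eq_true, zero_pow, zero_div] at h2
    exact h2.congr fun n => (h1 n).symm
  have hε1 : ∀ᶠ n in l, |g n * τ n| ≤ 1 := by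
    have := hlim.abs
    rw [abs_zero] at this
    exact this.eventually (Iic_mem_nhds one_pos)
  have hEn := hlim.eventually hE
  set A := effGen₁ E₁ W J with hA
  set C := effGen₂ E₀ E₁ E₂ W J with hC
  set W₁ := corrector₁ E₀ E₁ W J with hW₁
  let G : M →L[ℝ] M := ((γ : ℂ) • C).restrictScalars ℝ
  obtain ⟨K, hK0, hK⟩ := lipschitz_and_euler_of_linear_ode G (r := r) hr t₁
  have hcorr₁ := corrector₁_equation (E₁ := E₁) hWJ hW hsum
  have hR0 : ∀ n : ι, 0 ≤ R := fun n => (norm_nonneg _).trans (hR n 0)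
  have hClose : ∀ W₂ : V →L[ℂ] M, ∀ η > 0, ∀ᶠ n in l, ∀ k,
      ‖correctedObs W W₁ W₂ (g n * τ n) (Φ n k) - W (Φ n k)‖ ≤ η := by
    intro W₂ η hη
    have h1 : Tendsto (fun n => (‖W₁‖ + ‖W₂‖) * |g n * τ n| * R) l (𝓝 0) := by
      simpa using (hlim.abs.const_mul (‖W₁‖ + ‖W₂‖)).mul_const R
    filter_upwards [hε1, h1.eventually (Iic_mem_nhds hη)] with n h2 h3 k
    refine (norm_correctedObs_sub_le W W₁ W₂ h2 _).trans (le_trans ?_ h3)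
    gcongr
    exact hR n k
  have hEuler : ∀ n, ∀ k : ℕ, (k + 1) * τ n ≤ t₁ →
      ‖r ((k + 1) * τ n) - r (k * τ n) - (γ * τ n : ℂ) • C (r (k * τ n))‖ ≤ K * τ n * τ n := by
    intro n k hk
    have h1 := (hK (k * τ n) ((k + 1) * τ n) (by have := hτ n; positivity)
      (by nlinarith [hτ n]) hk).2
    have h2 : ((k : ℝ) + 1) * τ n - k * τ n = τ n := by ring
    rw [h2] at h1
    have h3 : τ n • G (r (k * τ n)) = (γ * τ n : ℂ) • C (r (k * τ n)) := by
      change τ n • (γ : ℂ) • C (r (k * τ n)) = _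
      rw [← smul_one_smul ℂ (τ n) ((γ : ℂ) • C (r (k * τ n))), smul_smul, mul_comm]
      simp
    rw [h3] at h1
    linarith
  have hstepbound : ∀ W₂ : V →L[ℂ] M, ∀ A' : M →L[ℂ] M,
      W ∘L E₂ + W₁ ∘L E₁ + W₂ ∘L E₀ = W₂ + A' ∘L W₁ + C ∘L W → ∀ η > 0, ∀ᶠ n in l, ∀ k : ℕ,
      ‖correctedObs W W₁ W₂ (g n * τ n) (Φ n (k + 1)) -
        (correctedObs W W₁ W₂ (g n * τ n) (Φ n k) + ((g n * τ n : ℝ) : ℂ) • A (W (Φ n k)) +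
        (γ * τ n : ℂ) • A' (W₁ (Φ n k)) +
        (γ * τ n : ℂ) • C (correctedObs W W₁ W₂ (g n * τ n) (Φ n k)))‖ ≤ η * τ n := by
    intro W₂ A' h₂ η hη
    obtain ⟨L, hL0, hL⟩ := norm_correctedObs_step_le hW hcorr₁ h₂ hc
    have h3 : Tendsto (fun n => L * (γ * |g n * τ n|) * R) l (𝓝 0) := by
      simpa using ((hlim.abs.const_mul γ).const_mul L).mul_const R
    -- The bound on C (s - W Z) is to cost half of ητ; adding 1 to ‖C‖ keeps the denominator
    -- positive when C = 0.
    set η' := η / (2 * (γ * (‖C‖ + 1))) with hη'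
    have hη'pos : 0 < η' := by positivity
    filter_upwards [hε1, hEn, h3.eventually (Iic_mem_nhds (half_pos hη)),
      hClose W₂ η' hη'pos] with n h4 h5 h6 h7 k
    have h8 := hL (g n * τ n) (E (g n * τ n)) h4 h5 (Φ n k)
    rw [← hΦ] at h8
    have hsq : (((g n * τ n : ℝ) : ℂ)) ^ 2 = γ * τ n := by
      rw [← Complex.ofReal_pow, hε2]; push_cast; rfl
    rw [hsq] at h8
    set s := correctedObs W W₁ W₂ (g n * τ n) (Φ n k)
    set s' := correctedObs W W₁ W₂ (g n * τ n) (Φ n (k + 1))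
    have h9 : ‖(γ * τ n : ℂ) • C (s - W (Φ n k))‖ ≤ η / 2 * τ n := by
      rw [norm_smul, norm_mul, Complex.norm_real, Complex.norm_real, Real.norm_of_nonneg hγ.le,
        Real.norm_of_nonneg (hτ n).le]
      have e1 : ‖C (s - W (Φ n k))‖ ≤ (‖C‖ + 1) * η' :=
        (C.le_opNorm _).trans (mul_le_mul (by linarith) (h7 k) (norm_nonneg _) (by positivity))
      calc γ * τ n * ‖C (s - W (Φ n k))‖ ≤ γ * τ n * ((‖C‖ + 1) * η') := by
            have := hτ n
            gcongr
        _ = η / 2 * τ n := by rw [hη']; field_simp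
    have h10 : L * |g n * τ n| ^ 3 * ‖Φ n k‖ ≤ η / 2 * τ n := by
      calc L * |g n * τ n| ^ 3 * ‖Φ n k‖ ≤ L * |g n * τ n| ^ 3 * R := by gcongr; exact hR n k
        _ = L * (γ * |g n * τ n|) * R * τ n := by
            rw [pow_succ, sq_abs, hε2]; ring
        _ ≤ _ := by have := hτ n; gcongr
    rw [map_sub] at h9
    set y := W (Φ n k)
    calc _ = ‖(s' - (s + ((g n * τ n : ℝ) : ℂ) • A y + (γ * τ n : ℂ) • A' (W₁ (Φ n k)) +
            (γ * τ n : ℂ) • C y)) - (γ * τ n : ℂ) • (C s - C y)‖ := by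
          congr 1; module
      _ ≤ _ := norm_sub_le _ _
      _ ≤ η * τ n := by linarith
  have hKτ : Tendsto (fun n => K * τ n) l (𝓝 0) := by simpa using hτ0.const_mul K
  have hCnorm : ∀ n, ∀ x : M, ‖(γ * τ n : ℂ) • C x‖ ≤ γ * ‖C‖ * τ n * ‖x‖ := by
    intro n x
    rw [norm_smul, norm_mul, Complex.norm_real, Complex.norm_real, Real.norm_of_nonneg hγ.le,
        Real.norm_of_nonneg (hτ n).le]
    calc γ * τ n * ‖C x‖ ≤ γ * τ n * (‖C‖ * ‖x‖) := by
          have := hτ n; gcongr; exact C.le_opNorm x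
      _ = _ := by ring
  have hlip : ∀ t s : ℝ, 0 ≤ t → t ≤ s → s ≤ t₁ → ‖r s - r t‖ ≤ K * (s - t) :=
    fun t s ht hts hs => (hK t s ht hts hs).1
  rcases hvanish with hv | hv
  -- With A' = A the terms εA W + ε²A W₁ combine into εA applied to the corrected observable, up to
  -- ε³A W₂. As A kills r, this is εA applied to the error s - x, which `hstab` controls.
  · obtain ⟨W₂, h₂⟩ := exists_corrector₂ (E₁ := E₁) (E₂ := E₂) hWJ hW hJ hsum A
    refine tendstoUniformlyOn_floor_of_step (a := γ * (b + ‖C‖))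
      (s := fun n k => correctedObs W W₁ W₂ (g n * τ n) (Φ n k)) hτ hτ0 (by positivity)
      hlip hK0 hr₀ (hClose W₂) ?_
    intro η hη
    have hη3 : 0 < η / 3 := by positivity
    have hlast : Tendsto (fun n => γ * |g n * τ n| * (‖A‖ * (‖W₂‖ * R))) l (𝓝 0) := by
      simpa using (hlim.abs.const_mul γ).mul_const (‖A‖ * (‖W₂‖ * R))
    filter_upwards [hstepbound W₂ A h₂ (η / 3) hη3, hKτ.eventually (Iic_mem_nhds hη3),
      hlast.eventually (Iic_mem_nhds hη3)] with n h1 h2 h3 k hk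
    have h4 := h1 k
    have h5 := hEuler n k hk
    have hτn := hτ n
    have h6 := hv (k * τ n) (by positivity)
    set s := correctedObs W W₁ W₂ (g n * τ n) (Φ n k) with hs
    set s' := correctedObs W W₁ W₂ (g n * τ n) (Φ n (k + 1))
    set y := W (Φ n k)
    set x := r (k * τ n)
    set x' := r ((k + 1) * τ n)
    have hsq : (((g n * τ n : ℝ) : ℂ)) ^ 2 = γ * τ n := by
      rw [← Complex.ofReal_pow, hε2]; push_cast; rfl
    have hsy : ((g n * τ n : ℝ) : ℂ) • A s = ((g n * τ n : ℝ) : ℂ) • A y +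
        (γ * τ n : ℂ) • A (W₁ (Φ n k)) +
        (((g n * τ n : ℝ) : ℂ) * (γ * τ n)) • A (W₂ (Φ n k)) := by
      rw [← hsq, hs]
      simp only [correctedObs, add_apply, smul_apply, map_add, map_smul]
      module
    have h7 : ‖(((g n * τ n : ℝ) : ℂ) * (γ * τ n)) • A (W₂ (Φ n k))‖ ≤ η / 3 * τ n := by
      rw [norm_smul, norm_mul, norm_mul, Complex.norm_real, Complex.norm_real, Complex.norm_real,
        Real.norm_of_nonneg hγ.le, Real.norm_of_nonneg hτn.le, Real.norm_eq_abs]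
      have e1 : ‖A (W₂ (Φ n k))‖ ≤ ‖A‖ * (‖W₂‖ * R) :=
        (A.le_opNorm _).trans (by
          gcongr; exact (W₂.le_opNorm _).trans (by gcongr; exact hR n k))
      calc |g n * τ n| * (γ * τ n) * ‖A (W₂ (Φ n k))‖
          ≤ |g n * τ n| * (γ * τ n) * (‖A‖ * (‖W₂‖ * R)) := by gcongr
        _ = γ * |g n * τ n| * (‖A‖ * (‖W₂‖ * R)) * τ n := by ring
        _ ≤ _ := by gcongr
    have h8 : K * τ n * τ n ≤ η / 3 * τ n := by gcongr
    have h9 := hCnorm n (s - x)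
    have h10 := hstab (g n * τ n) (s - x)
    rw [hε2] at h10
    calc ‖s' - x'‖ = ‖(((s - x) + ((g n * τ n : ℝ) : ℂ) • A (s - x)) +
            (γ * τ n : ℂ) • C (s - x)) +
          (s' - (s + ((g n * τ n : ℝ) : ℂ) • A y + (γ * τ n : ℂ) • A (W₁ (Φ n k)) +
            (γ * τ n : ℂ) • C s)) -
          ((((g n * τ n : ℝ) : ℂ) * (γ * τ n)) • A (W₂ (Φ n k)) +
            (x' - x - (γ * τ n : ℂ) • C x))‖ := by
          congr 1
          rw [map_sub, map_sub, h6, sub_zero, hsy]; module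
      _ ≤ _ := (norm_sub_le _ _).trans (add_le_add_left (norm_add_le _ _) _)
      _ ≤ ((1 + b * (γ * τ n)) * ‖s - x‖ + γ * ‖C‖ * τ n * ‖s - x‖) + η / 3 * τ n +
            (η / 3 * τ n + η / 3 * τ n) := by
          gcongr
          · exact (norm_add_le _ _).trans (by gcongr)
          · exact (norm_add_le _ _).trans (add_le_add h7 (h5.trans h8))
      _ = _ := by ring
  -- With A' = 0 only εA W remains, which involves the exact state itself; the assumed uniform limit
  -- makes it o(τ).
  · obtain ⟨W₂, h₂⟩ := exists_corrector₂ (E₁ := E₁) (E₂ := E₂) hWJ hW hJ hsum 0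
    refine tendstoUniformlyOn_floor_of_step (a := γ * ‖C‖)
      (s := fun n k => correctedObs W W₁ W₂ (g n * τ n) (Φ n k)) hτ hτ0 (by positivity)
      hlip hK0 hr₀ (hClose W₂) ?_
    intro η hη
    have hv' := hv t₁
    rw [Metric.tendstoUniformlyOn_iff] at hv'
    have hη3 : 0 < η / 3 := by positivity
    filter_upwards [hstepbound W₂ 0 h₂ (η / 3) hη3, hKτ.eventually (Iic_mem_nhds hη3),
      hv' (η / 3) hη3] with n h1 h2 h3 k hk
    have h4 := h1 k
    have h5 := hEuler n k hk
    have hτn := hτ n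
    -- The uniform limit is sampled at t = kτ, where the floor of t / τ is k.
    have h6 := h3 (k * τ n) ⟨by positivity, by nlinarith⟩
    rw [mul_div_cancel_right₀ _ hτn.ne', Nat.floor_natCast, dist_zero_left] at h6
    set s := correctedObs W W₁ W₂ (g n * τ n) (Φ n k)
    set s' := correctedObs W W₁ W₂ (g n * τ n) (Φ n (k + 1))
    set y := W (Φ n k)
    set x := r (k * τ n)
    set x' := r ((k + 1) * τ n)
    have h7 : ‖((g n * τ n : ℝ) : ℂ) • A y‖ ≤ η / 3 * τ n := by
      have : ((g n * τ n : ℝ) : ℂ) • A y = (τ n : ℂ) • ((g n : ℂ) • A y) := by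
        rw [smul_smul]; push_cast; ring_nf
      rw [this, norm_smul, Complex.norm_real, Real.norm_of_nonneg hτn.le, mul_comm]
      gcongr
    have h8 : K * τ n * τ n ≤ η / 3 * τ n := by gcongr
    have h9 := hCnorm n (s - x)
    simp only [zero_apply, smul_zero, add_zero] at h4
    calc ‖s' - x'‖ = ‖((s - x) + (γ * τ n : ℂ) • C (s - x)) +
          (s' - (s + ((g n * τ n : ℝ) : ℂ) • A y + (γ * τ n : ℂ) • C s)) +
          (((g n * τ n : ℝ) : ℂ) • A y - (x' - x - (γ * τ n : ℂ) • C x))‖ := by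
          congr 1; rw [map_sub]; module
      _ ≤ _ := norm_add₃_le
      _ ≤ (‖s - x‖ + γ * ‖C‖ * τ n * ‖s - x‖) + η / 3 * τ n + (η / 3 * τ n + η / 3 * τ n) := by
          gcongr
          · exact (norm_add_le _ _).trans (by gcongr)
          · exact (norm_sub_le _ _).trans (add_le_add h7 (h5.trans h8))
      _ = _ := by ring

end Convergence

/-! ### Spectral theory of the transfer matrix. -/

section SpectralLimit

open Polynomial
open scoped Matrix.Norms.L2Operator

variable {p : Type*} [Fintype p] [DecidableEq p]

theorem aeval_mulVec_of_mulVec_eq_smul {T : Matrix p p ℂ} {v : p → ℂ} {μ : ℂ}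
    (h : T *ᵥ v = μ • v) (q : ℂ[X]) : aeval T q *ᵥ v = q.eval μ • v := by
  induction q using Polynomial.induction_on' with
  | add f g hf hg => rw [map_add, Matrix.add_mulVec, hf, hg, eval_add, add_smul]
  | monomial n a =>
    have hn : T ^ n *ᵥ v = μ ^ n • v := by
      induction n with
      | zero => simp
      | succ n ih => rw [pow_succ, ← Matrix.mulVec_mulVec, h, Matrix.mulVec_smul, ih, smul_smul,
          pow_succ, mul_comm]
    rw [aeval_monomial, eval_monomial, ← Algebra.smul_def, Matrix.smul_mulVec, hn, smul_smul]

/-- Gelfand's formula: the spectral radius is below 1, so the norms of the powers are eventually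
dominated by a geometric sequence. -/
theorem summable_pow_of_spectrum [Nonempty p] (R : Matrix p p ℂ)
    (hR : ∀ z ∈ spectrum ℂ R, ‖z‖ < 1) : Summable fun m : ℕ => R ^ m := by
  have : CompleteSpace (Matrix p p ℂ) := FiniteDimensional.complete ℂ _
  have h1 : spectralRadius ℂ R < (1 : NNReal) :=
    spectrum.spectralRadius_lt_of_forall_lt R fun z hz => by exact_mod_cast hR z hz
  obtain ⟨r, hr, hr1⟩ := ENNReal.lt_iff_exists_nnreal_btwn.1 h1
  have h2 := spectrum.pow_nnnorm_pow_one_div_tendsto_nhds_spectralRadius R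
  have h3 := h2.eventually (gt_mem_nhds hr)
  have hr1' : (r : ℝ) < 1 := by exact_mod_cast hr1
  refine Summable.of_norm_bounded_eventually_nat (g := fun m : ℕ => (r : ℝ) ^ m)
    (summable_geometric_of_lt_one r.2 hr1') ?_
  filter_upwards [h3, eventually_gt_atTop 0] with m hm hm0
  have hm' : (0 : ℝ) < m := by exact_mod_cast hm0
  have h4 : ((‖R ^ m‖₊ : ENNReal) ^ (1 / (m : ℝ))) ^ (m : ℝ) ≤ (r : ENNReal) ^ (m : ℝ) :=
    ENNReal.rpow_le_rpow hm.le hm'.le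
  rw [← ENNReal.rpow_mul, one_div_mul_cancel hm'.ne', ENNReal.rpow_one, ENNReal.rpow_natCast] at h4
  exact_mod_cast h4

/-- Write the characteristic polynomial as (X - 1) q, with all roots of q in the open disc. By
Cayley–Hamilton the columns of P = q(T) / q(1) are fixed by T. The fixed space is the line through u
because the eigenvalue 1 is simple, so P has the form u wᵀ. Deflating by P leaves only eigenvalues
that are 0 or roots of q. -/
theorem exists_summable_pow_sub_vecMulVec {T : Matrix p p ℂ} {u : p → ℂ} (hu : u ≠ 0)
    (hTu : T *ᵥ u = u) (hT : ∀ z ∈ T.charpoly.roots.erase 1, ‖z‖ < 1) :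
    ∃ w : p → ℂ, w ⬝ᵥ u = 1 ∧ Summable fun m : ℕ => T ^ m - Matrix.vecMulVec u w := by
  have : Nonempty p := by
    by_contra h
    rw [not_nonempty_iff] at h
    exact hu (Subsingleton.elim _ _)
  have hTu' : T *ᵥ u = (1 : ℂ) • u := by rw [hTu, one_smul]
  have hroot : ∀ {μ : ℂ} {v : p → ℂ}, v ≠ 0 → T *ᵥ v = μ • v → T.charpoly.eval μ = 0 := by
    intro μ v hv h
    have := aeval_mulVec_of_mulVec_eq_smul h T.charpoly
    rw [Matrix.aeval_self_charpoly, Matrix.zero_mulVec] at this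
    exact (smul_eq_zero.1 this.symm).resolve_right hv
  have hmonic := T.charpoly_monic
  have h1mem : (1 : ℂ) ∈ T.charpoly.roots := (mem_roots hmonic.ne_zero).2 (hroot hu hTu')
  set q : ℂ[X] := ((T.charpoly.roots.erase 1).map fun a => X - C a).prod with hq
  have hfac : T.charpoly = (X - C 1) * q := by
    have h1 := (IsAlgClosed.splits T.charpoly).eq_prod_roots_of_monic hmonic
    rw [h1, hq, ← Multiset.prod_cons, ← Multiset.map_cons (fun a => X - C a),
      Multiset.cons_erase h1mem]
  have hqroot : ∀ z, q.eval z = 0 → ‖z‖ < 1 := by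
    intro z hz
    rw [hq, eval_multiset_prod, Multiset.prod_eq_zero_iff] at hz
    simp only [Multiset.map_map, Function.comp_def, eval_sub, eval_X, eval_C,
      Multiset.mem_map, sub_eq_zero] at hz
    obtain ⟨a, ha, rfl⟩ := hz
    exact hT _ ha
  have hq1 : q.eval 1 ≠ 0 := fun h => by simpa using hqroot 1 h
  have hTq : T * aeval T q = aeval T q := by
    have h1 := T.aeval_self_charpoly
    rw [hfac, map_mul, map_sub, aeval_X, aeval_C, map_one, sub_mul, one_mul, sub_eq_zero] at h1
    exact h1
  set P := (q.eval 1)⁻¹ • aeval T q with hP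
  have hTP : T * P = P := by rw [hP, Matrix.mul_smul, hTq]
  have hPT : P * T = P := by
    have : Commute T (aeval T q) := by
      have := (Algebra.commute_of_mem_adjoin_self (R := ℂ) (aeval_mem_adjoin_singleton ℂ T (p := q)))
      exact this
    rw [hP, Matrix.smul_mul, ← this.eq, hTq]
  have hPu : P *ᵥ u = u := by
    rw [hP, Matrix.smul_mulVec, aeval_mulVec_of_mulVec_eq_smul hTu', smul_smul,
      inv_mul_cancel₀ hq1, one_smul]
  have hrank : ∀ v : p → ℂ, T *ᵥ v = v → ∃ c : ℂ, c • u = v := by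
    have h1 := LinearMap.finrank_eigenspace_le (Matrix.toLin' T) 1
    have h2 : rootMultiplicity 1 (LinearMap.charpoly (Matrix.toLin' T)) = 1 := by
      rw [Matrix.charpoly_toLin', hfac, rootMultiplicity_mul (by rw [← hfac]; exact hmonic.ne_zero),
        rootMultiplicity_X_sub_C_self, rootMultiplicity_eq_zero hq1]
    rw [h2] at h1
    have hmem : ∀ v : p → ℂ, T *ᵥ v = v → v ∈ Module.End.eigenspace (Matrix.toLin' T) 1 := by
      intro v hv
      rw [Module.End.mem_eigenspace_iff, Matrix.toLin'_apply, hv, one_smul]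
    have hne : (⟨u, hmem u hTu⟩ : Module.End.eigenspace (Matrix.toLin' T) 1) ≠ 0 := by
      simpa [Subtype.ext_iff] using hu
    have h3 : Module.finrank ℂ (Module.End.eigenspace (Matrix.toLin' T) 1) = 1 :=
      le_antisymm h1 (Module.finrank_pos_iff_exists_ne_zero.2 ⟨_, hne⟩)
    intro v hv
    obtain ⟨c, hc⟩ := (finrank_eq_one_iff_of_nonzero' _ hne).1 h3 ⟨v, hmem v hv⟩
    exact ⟨c, congrArg Subtype.val hc⟩
  have hcol : ∀ j, ∃ c : ℂ, c • u = P.col j := fun j => hrank _ (by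
    rw [← Matrix.mulVec_single_one, Matrix.mulVec_mulVec, hTP])
  choose w hw using hcol
  have hPw : P = Matrix.vecMulVec u w := by
    ext i j
    have := congrFun (hw j) i
    simp only [Pi.smul_apply, smul_eq_mul, Matrix.col_apply] at this
    rw [Matrix.vecMulVec_apply, ← this, mul_comm]
  have hwu : w ⬝ᵥ u = 1 := by
    obtain ⟨i, hi⟩ := Function.ne_iff.1 hu
    have h1 := congrFun hPu i
    rw [hPw, Matrix.vecMulVec_mulVec] at h1
    simp at h1
    exact mul_left_cancel₀ hi (h1.trans (mul_one _).symm)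
  have hPP : P * P = P := by
    rw [hPw, Matrix.vecMulVec_mul_vecMulVec, hwu, one_smul]
  refine ⟨w, hwu, ?_⟩
  rw [← hPw]
  have hpow : ∀ m : ℕ, (T - P) ^ (m + 1) = T ^ (m + 1) - P := by
    intro m
    induction m with
    | zero => simp
    | succ m ih =>
      have hTmP : T ^ (m + 1) * P = P := by
        clear ih
        induction m with
        | zero => simpa using hTP
        | succ m ih => rw [pow_succ, mul_assoc, hTP, ih]
      rw [pow_succ, ih, sub_mul, mul_sub, mul_sub, hTmP, hPT, hPP, ← pow_succ]
      abel
  -- An eigenvector v of T - P with z ≠ 0 satisfies P v = 0, because P (T - P) = 0. Hence T v = z v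
  -- and q(T) v = 0, which forces q(z) = 0.
  have hspec : ∀ z ∈ spectrum ℂ (T - P), ‖z‖ < 1 := by
    intro z hz
    by_cases hz0 : z = 0
    · simp [hz0]
    rw [← Matrix.spectrum_toLin', ← Module.End.hasEigenvalue_iff_mem_spectrum] at hz
    obtain ⟨v, hv⟩ := hz.exists_hasEigenvector
    have hv1 := hv.apply_eq_smul
    rw [Matrix.toLin'_apply] at hv1
    have hPv : P *ᵥ v = 0 := by
      have h1 : P *ᵥ ((T - P) *ᵥ v) = 0 := by
        rw [Matrix.mulVec_mulVec, mul_sub, hPT, hPP, sub_self, Matrix.zero_mulVec]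
      rw [hv1, Matrix.mulVec_smul] at h1
      exact (smul_eq_zero.1 h1).resolve_left hz0
    have hTv : T *ᵥ v = z • v := by
      rw [Matrix.sub_mulVec, hPv, sub_zero] at hv1
      exact hv1
    refine hqroot z ?_
    have h1 := aeval_mulVec_of_mulVec_eq_smul hTv q
    have h2 : aeval T q *ᵥ v = 0 := by
      rw [hP, Matrix.smul_mulVec] at hPv
      exact (smul_eq_zero.1 hPv).resolve_left (inv_ne_zero hq1)
    rw [h2] at h1
    exact (smul_eq_zero.1 h1.symm).resolve_right hv.2
  have hs := summable_pow_of_spectrum (T - P) hspec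
  -- The powers of T - P agree with T^m - P only from m = 1 on, so the zeroth terms are dropped.
  rw [← summable_nat_add_iff 1] at hs ⊢
  exact hs.congr hpow

/-- Interpolate X^k at the eigenvalues. The minimal polynomial of a semisimple matrix is squarefree,
hence divides the interpolation error, which vanishes at every eigenvalue. The coefficient matrices
are the Lagrange basis evaluated at T and do not depend on k. -/
theorem exists_pow_eq_sum_of_isSemisimple (T : Matrix p p ℂ)
    (hT : Module.End.IsSemisimple (Matrix.toLin' T)) :
    ∃ Q : ℂ → Matrix p p ℂ, ∀ k : ℕ, T ^ k = ∑ z ∈ T.charpoly.roots.toFinset, z ^ k • Q z := by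
  set s := T.charpoly.roots.toFinset with hs
  refine ⟨fun z => aeval T (Lagrange.basis s id z), fun k => ?_⟩
  set f : ℂ[X] := X ^ k - ∑ z ∈ s, C (z ^ k) * Lagrange.basis s id z with hf
  have hroot : ∀ y ∈ s, f.eval y = 0 := by
    intro y hy
    have h1 : ∀ z ∈ s, eval y (C (z ^ k) * Lagrange.basis s id z) = if z = y then y ^ k else 0 := by
      intro z hz
      split_ifs with h
      · subst h
        have := Lagrange.eval_basis_self (v := id) (s := s) (Function.injective_id.injOn) hz
        simp only [id] at this
        simp [this]
      · have := Lagrange.eval_basis_of_ne (v := id) (s := s) h hy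
        simp only [id] at this
        simp [this]
    rw [hf, eval_sub, eval_finsetSum, Finset.sum_congr rfl h1]
    simp [hy]
  have hdvd : minpoly ℂ T ∣ f := by
    by_cases hf0 : f = 0
    · rw [hf0]; exact dvd_zero _
    have hsq : Squarefree (minpoly ℂ T) := by
      rw [← Matrix.minpoly_toLin']; exact hT.minpoly_squarefree
    have hnodup : (minpoly ℂ T).roots.Nodup :=
      nodup_roots (PerfectField.separable_iff_squarefree.2 hsq)
    refine (IsAlgClosed.splits (minpoly ℂ T)).dvd_of_roots_le_roots hsq.ne_zero ?_
    rw [Multiset.le_iff_subset hnodup]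
    intro z hz
    rw [mem_roots hf0]
    refine hroot z ?_
    rw [hs, Multiset.mem_toFinset]
    exact Multiset.mem_of_le (roots.le_of_dvd T.charpoly_monic.ne_zero T.minpoly_dvd_charpoly) hz
  have h0 : aeval T f = 0 := by
    obtain ⟨c, hc⟩ := hdvd
    rw [hc, map_mul, minpoly.aeval, zero_mul]
  rw [hf, map_sub, map_pow, aeval_X, map_sum, sub_eq_zero] at h0
  rw [h0]
  refine Finset.sum_congr rfl fun z _ => ?_
  rw [map_mul, aeval_C, ← Algebra.smul_def]

/-- Outside the open disc only the eigenvalue 1 can occur. Its contribution is constant in k, so it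
is the limit P. -/
theorem exists_pow_sub_eq_sum_of_isSemisimple {T P : Matrix p p ℂ}
    (hT : Module.End.IsSemisimple (Matrix.toLin' T))
    (hroots : ∀ z ∈ T.charpoly.roots, z ≠ 1 → ‖z‖ < 1)
    (hlim : Tendsto (fun m : ℕ => T ^ m) atTop (𝓝 P)) :
    ∃ Q : ℂ → Matrix p p ℂ, ∀ k : ℕ,
      T ^ k - P = ∑ z ∈ T.charpoly.roots.toFinset.filter (fun z => ‖z‖ < 1), z ^ k • Q z := by
  obtain ⟨Q, hQ⟩ := exists_pow_eq_sum_of_isSemisimple T hT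
  refine ⟨Q, fun k => ?_⟩
  have hsplit : ∀ k : ℕ, T ^ k =
      ∑ z ∈ T.charpoly.roots.toFinset.filter (fun z => ‖z‖ < 1), z ^ k • Q z +
      ∑ z ∈ T.charpoly.roots.toFinset.filter (fun z => ¬ ‖z‖ < 1), Q z := by
    intro k
    rw [hQ k, ← Finset.sum_filter_add_sum_filter_not _ (fun z : ℂ => ‖z‖ < 1)]
    congr 1
    refine Finset.sum_congr rfl fun z hz => ?_
    rw [Finset.mem_filter, Multiset.mem_toFinset] at hz
    have : z = 1 := by
      by_contra h
      exact hz.2 (hroots z hz.1 h)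
    rw [this, one_pow, one_smul]
  have hlim' : Tendsto (fun m : ℕ => T ^ m) atTop
      (𝓝 (0 + ∑ z ∈ T.charpoly.roots.toFinset.filter (fun z => ¬ ‖z‖ < 1), Q z)) := by
    simp_rw [hsplit]
    refine Tendsto.add_const _ ?_
    rw [← Finset.sum_const_zero]
    refine tendsto_finsetSum _ fun z hz => ?_
    have := (tendsto_pow_atTop_nhds_zero_of_norm_lt_one (Finset.mem_filter.1 hz).2).smul_const (Q z)
    simpa using this
  rw [tendsto_nhds_unique hlim hlim', hsplit k]
  abel

end SpectralLimit

/-! ### Block calculus over the ancilla indices. -/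

section Blocks

variable {S A D β : Type*} [Fintype S] [DecidableEq S] [Fintype A] [DecidableEq A]
  [Fintype D] [DecidableEq D] [Fintype β] {n : ℕ}

/-- The block of an operator on the composite system at the ancilla indices `i`, `j`. -/
def blk {S A : Type*} (X : Matrix (S × A) (S × A) ℂ) (i j : A) : Matrix S S ℂ :=
  Matrix.of fun s s' => X (s, i) (s', j)

theorem blk_mul (X Y : Matrix (S × A) (S × A) ℂ) (i j : A) :
    blk (X * Y) i j = ∑ k, blk X i k * blk Y k j := by
  ext s s'
  simp only [blk, Matrix.of_apply, Matrix.mul_apply, Matrix.sum_apply, Fintype.sum_prod_type]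
  exact Finset.sum_comm

theorem blk_one (i j : A) : blk (1 : Matrix (S × A) (S × A) ℂ) i j = if i = j then 1 else 0 := by
  ext s s'
  by_cases h : i = j <;> simp [blk, Matrix.one_apply, h]

theorem blk_conjTranspose {S A : Type*} (X : Matrix (S × A) (S × A) ℂ) (i j : A) :
    blk Xᴴ i j = (blk X j i)ᴴ := rfl

theorem blk_add {S A : Type*} (X Y : Matrix (S × A) (S × A) ℂ) (i j : A) :
    blk (X + Y) i j = blk X i j + blk Y i j := rfl

theorem blk_sub {S A : Type*} (X Y : Matrix (S × A) (S × A) ℂ) (i j : A) :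
    blk (X - Y) i j = blk X i j - blk Y i j := rfl

theorem blk_smul {S A : Type*} (c : ℂ) (X : Matrix (S × A) (S × A) ℂ) (i j : A) :
    blk (c • X) i j = c • blk X i j := rfl

theorem blk_kronecker {S A : Type*} (ρ : Matrix S S ℂ) (ω : Matrix A A ℂ) (i j : A) :
    blk (ρ ⊗ₖ ω) i j = ω i j • ρ := by
  ext s s'
  simp [blk, mul_comm]

theorem ptrace_eq_sum_blk (X : Matrix (S × A) (S × A) ℂ) : ptrace X = ∑ a, blk X a a := by
  ext s s'
  simp [ptrace, blk, Matrix.sum_apply]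

theorem ptrace_mul_kronecker_mul (X Y : Matrix (S × A) (S × A) ℂ) (ρ : Matrix S S ℂ)
    (ω : Matrix A A ℂ) :
    ptrace (X * (ρ ⊗ₖ ω) * Y) = ∑ j, ∑ i, ∑ i', ω i i' • (blk X j i * ρ * blk Y i' j) := by
  simp_rw [ptrace_eq_sum_blk, blk_mul, blk_kronecker, Finset.sum_mul]
  refine Finset.sum_congr rfl fun j _ => ?_
  rw [Finset.sum_comm]
  simp

theorem blk_actOn {S A : Type*} [DecidableEq A] (X : Matrix (S × A) (S × A) ℂ) (m : Fin n)
    (x y : Fin n → A) :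
    blk (actOn X m) x y = if ∀ l, l ≠ m → x l = y l then blk X (x m) (y m) else 0 := by
  ext s s'
  simp only [blk, actOn, Matrix.of_apply]
  split_ifs <;> rfl

theorem sum_snoc {M : Type*} [AddCommMonoid M] (f : (Fin (n + 1) → A) → M) :
    ∑ x, f x = ∑ i : A, ∑ x : Fin n → A, f (Fin.snoc x i) := by
  rw [← Fintype.sum_prod_type']
  exact (Fintype.sum_equiv (Fin.snocEquiv fun _ => A) _ _ fun p => rfl).symm

theorem blk_actOn_castSucc {S A : Type*} [DecidableEq A] (X : Matrix (S × A) (S × A) ℂ)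
    (m : Fin n) (x y : Fin n → A) (i j : A) :
    blk (actOn X m.castSucc) (Fin.snoc x i) (Fin.snoc y j) =
      if i = j then blk (actOn X m) x y else 0 := by
  rw [blk_actOn, blk_actOn]
  simp only [Fin.snoc_castSucc, Fin.forall_fin_succ', Fin.snoc_last,
    (Fin.castSucc_injective n).ne_iff]
  have : Fin.last n ≠ m.castSucc := (Fin.castSucc_lt_last m).ne'
  by_cases h : i = j <;> simp [h, this]

theorem blk_actOn_last {S A : Type*} [DecidableEq A] (X : Matrix (S × A) (S × A) ℂ)
    (x y : Fin n → A) (i j : A) :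
    blk (actOn X (Fin.last n)) (Fin.snoc x i) (Fin.snoc y j) =
      if x = y then blk X i j else 0 := by
  rw [blk_actOn]
  simp only [Fin.snoc_castSucc, Fin.forall_fin_succ', Fin.snoc_last, funext_iff]
  simp [(Fin.castSucc_lt_last _).ne]

theorem blk_prod_castSucc (X : Matrix (S × A) (S × A) ℂ) (L : List (Fin n))
    (x y : Fin n → A) (i j : A) :
    blk (L.map fun m => actOn X m.castSucc).prod (Fin.snoc x i) (Fin.snoc y j) =
      if i = j then blk (L.map fun m => actOn X m).prod x y else 0 := by
  induction L generalizing x i with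
  | nil =>
    simp only [List.map_nil, List.prod_nil, blk_one, Fin.snoc_inj]
    by_cases h : i = j <;> simp [h]
  | cons m L ih =>
    simp only [List.map_cons, List.prod_cons, blk_mul, sum_snoc, ih, blk_actOn_castSucc]
    by_cases h : i = j
    · simp [h]
    · simp [h]

/-- The last collision touches only the last ancilla and the earlier ones leave it alone, so their
blocks simply multiply. This is what makes the dynamics recursive in the number of collisions. -/
theorem blk_collisions_succ (U : Matrix (S × A) (S × A) ℂ) (x y : Fin n → A) (i j : A) :
    blk (collisions U (n + 1)) (Fin.snoc x i) (Fin.snoc y j) =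
      blk U i j * blk (collisions U n) x y := by
  have h1 : collisions U (n + 1) = actOn U (Fin.last n) *
      ((List.finRange n).reverse.map fun m => actOn U m.castSucc).prod := by
    rw [collisions, List.ofFn_succ', List.concat_eq_append, List.reverse_append,
      List.reverse_singleton, List.singleton_append, List.prod_cons, List.map_reverse,
      List.ofFn_eq_map]
  have h2 : collisions U n = ((List.finRange n).reverse.map fun m => actOn U m).prod := by
    rw [collisions, List.map_reverse, List.ofFn_eq_map]
  rw [h1, h2, blk_mul, sum_snoc]
  simp_rw [blk_actOn_last, blk_prod_castSucc]
  simp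

end Blocks

/-! ### The joint dynamics of system and bond. -/

section Step

variable {S A D β : Type*} [Fintype S] [DecidableEq S] [Fintype A] [DecidableEq A]
  [Fintype D] [DecidableEq D] [Fintype β] {n : ℕ}

/-- The joint evolution of the system and of the bond in a single collision with the ancilla,
`X` acting from the left and `Y` from the right. -/
def stepMap (B : β → A → Matrix D D ℂ) :
    Matrix (S × A) (S × A) ℂ →ₗ[ℂ] Matrix (S × A) (S × A) ℂ →ₗ[ℂ]
      (D × D → Matrix S S ℂ) →ₗ[ℂ] (D × D → Matrix S S ℂ) :=
  LinearMap.mk₂ ℂ (fun X Y =>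
    { toFun := fun Z c => ∑ a, ∑ j, ∑ i, ∑ i', mTensor B i i' a c • (blk X j i * Z a * blk Y i' j)
      map_add' := fun Z Z' => by
        ext1 c
        simp only [Pi.add_apply, mul_add, add_mul, smul_add, Finset.sum_add_distrib]
      map_smul' := fun r Z => by
        ext1 c
        simp only [Pi.smul_apply, Matrix.mul_smul, Matrix.smul_mul, Finset.smul_sum,
          RingHom.id_apply, smul_comm r] })
    (fun X X' Y => by
      refine LinearMap.ext fun Z => funext fun c => ?_
      simp only [blk_add, add_mul, smul_add, Finset.sum_add_distrib, LinearMap.coe_mk,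
        AddHom.coe_mk]
      rfl)
    (fun r X Y => by
      refine LinearMap.ext fun Z => funext fun c => ?_
      change _ = r • ∑ a, ∑ j, ∑ i, ∑ i', mTensor B i i' a c • (blk X j i * Z a * blk Y i' j)
      simp only [blk_smul, Matrix.smul_mul, Finset.smul_sum, LinearMap.coe_mk,
        AddHom.coe_mk, smul_comm r])
    (fun X Y Y' => by
      refine LinearMap.ext fun Z => funext fun c => ?_
      simp only [blk_add, mul_add, smul_add, Finset.sum_add_distrib, LinearMap.coe_mk,
        AddHom.coe_mk]
      rfl)
    (fun r X Y => by
      refine LinearMap.ext fun Z => funext fun c => ?_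
      change _ = r • ∑ a, ∑ j, ∑ i, ∑ i', mTensor B i i' a c • (blk X j i * Z a * blk Y i' j)
      simp only [blk_smul, Matrix.mul_smul, Finset.smul_sum, LinearMap.coe_mk,
        AddHom.coe_mk, smul_comm r])

theorem stepMap_apply (B : β → A → Matrix D D ℂ) (X Y : Matrix (S × A) (S × A) ℂ)
    (Z : D × D → Matrix S S ℂ) (c : D × D) :
    stepMap B X Y Z c =
      ∑ a, ∑ j, ∑ i, ∑ i', mTensor B i i' a c • (blk X j i * Z a * blk Y i' j) := rfl

/-- The contraction of the bond indices. -/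
def bondTrace : (D × D → Matrix S S ℂ) →ₗ[ℂ] Matrix S S ℂ where
  toFun Z := ∑ d : D, Z (d, d)
  map_add' Z Z' := by simp [Finset.sum_add_distrib]
  map_smul' r Z := by simp [Finset.smul_sum]

theorem bondTrace_apply (Z : D × D → Matrix S S ℂ) : bondTrace Z = ∑ d : D, Z (d, d) := rfl

/-- The uncorrelated state of the system and of the bond. -/
def bondProd (w : D × D → ℂ) : Matrix S S ℂ →ₗ[ℂ] (D × D → Matrix S S ℂ) where
  toFun ρ c := w c • ρ
  map_add' ρ ρ' := by ext1 c; simp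
  map_smul' r ρ := by ext1 c; simp [smul_comm r]

theorem bondProd_apply (w : D × D → ℂ) (ρ : Matrix S S ℂ) (c : D × D) :
    bondProd w ρ c = w c • ρ := rfl

/-- The contraction vector of the bond indices. -/
def bondVec : D × D → ℂ := fun p => if p.1 = p.2 then 1 else 0

theorem dotProduct_bondVec (v : D × D → ℂ) : v ⬝ᵥ bondVec = ∑ d, v (d, d) := by
  simp [dotProduct, bondVec, Fintype.sum_prod_type]

theorem mulVec_bondVec (N : Matrix (D × D) (D × D) ℂ) (a : D × D) :
    (N *ᵥ bondVec) a = ∑ d, N a (d, d) := dotProduct_bondVec _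

/-- The row vector of the bond indices attached to a matrix element of the state of the first
`n` ancillas. -/
def bondRow (B : β → A → Matrix D D ℂ) (χ₀ : Matrix D D ℂ) (x y : Fin n → A) : D × D → ℂ :=
  (fun p : D × D => χ₀ p.1 p.2) ᵥ* (List.ofFn fun l => mTensor B (x l) (y l)).prod

theorem mpdo_eq_bondRow (B : β → A → Matrix D D ℂ) (χ₀ : Matrix D D ℂ) (x y : Fin n → A) :
    mpdo B χ₀ n x y = bondRow B χ₀ x y ⬝ᵥ bondVec := by
  rw [bondRow, ← Matrix.dotProduct_mulVec]
  rfl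

theorem bondRow_snoc (B : β → A → Matrix D D ℂ) (χ₀ : Matrix D D ℂ) (x y : Fin n → A) (i j : A) :
    bondRow B χ₀ (Fin.snoc x i : Fin (n + 1) → A) (Fin.snoc y j : Fin (n + 1) → A) =
      bondRow B χ₀ x y ᵥ* mTensor B i j := by
  rw [bondRow, bondRow, List.ofFn_succ', List.concat_eq_append, List.prod_append,
    List.prod_singleton, Matrix.vecMul_vecMul]
  simp

theorem sum_comm_seven {α₁ α₂ α₃ α₄ α₅ α₆ α₇ M : Type*} [Fintype α₁] [Fintype α₂] [Fintype α₃]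
    [Fintype α₄] [Fintype α₅] [Fintype α₆] [Fintype α₇] [AddCommMonoid M]
    (f : α₁ → α₂ → α₃ → α₄ → α₅ → α₆ → α₇ → M) :
    ∑ a, ∑ j, ∑ i, ∑ i', ∑ z, ∑ x, ∑ y, f a j i i' z x y =
      ∑ j, ∑ z, ∑ i, ∑ x, ∑ i', ∑ y, ∑ a, f a j i i' z x y := by
  simp only [← Fintype.sum_prod_type']
  exact Fintype.sum_equiv
    ⟨fun p => (p.2.1, p.2.2.2.2.1, p.2.2.1, p.2.2.2.2.2.1, p.2.2.2.1, p.2.2.2.2.2.2, p.1),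
      fun q => (q.2.2.2.2.2.2, q.1, q.2.2.1, q.2.2.2.2.1, q.2.1, q.2.2.2.1, q.2.2.2.2.2.1),
      fun _ => rfl, fun _ => rfl⟩ _ _ fun _ => rfl

/-- The free bond index c must be kept open for the induction; contracting it afterwards gives the
system state. -/
theorem iterate_stepMap_eq (B : β → A → Matrix D D ℂ) (χ₀ : Matrix D D ℂ)
    (U : Matrix (S × A) (S × A) ℂ) (ρ₀ : Matrix S S ℂ) (k : ℕ) (c : D × D) :
    (stepMap B U Uᴴ)^[k] (bondProd (fun p : D × D => χ₀ p.1 p.2) ρ₀) c =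
      ∑ z : Fin k → A, ∑ x : Fin k → A, ∑ y : Fin k → A,
        bondRow B χ₀ x y c •
          (blk (collisions U k) z x * ρ₀ * blk (collisions U k)ᴴ y z) := by
  induction k generalizing c with
  | zero => simp [bondProd_apply, bondRow, collisions, blk_one]
  | succ k ih =>
    rw [Function.iterate_succ_apply', stepMap_apply]
    simp_rw [ih, sum_snoc, blk_conjTranspose, blk_collisions_succ, bondRow_snoc, Matrix.vecMul,
      dotProduct, Matrix.conjTranspose_mul, Finset.mul_sum, Finset.sum_mul, Finset.smul_sum,
      Finset.sum_smul]
    rw [sum_comm_seven]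
    iterate 7 refine Finset.sum_congr rfl fun _ _ => ?_
    rw [Matrix.mul_smul, Matrix.smul_mul, smul_smul, mul_comm]
    simp only [Matrix.mul_assoc]

theorem systemState_eq_iterate (B : β → A → Matrix D D ℂ) (χ₀ : Matrix D D ℂ)
    (H : Matrix (S × A) (S × A) ℂ) (g τ : ℝ) (ρ₀ : Matrix S S ℂ) (k : ℕ) :
    systemState B χ₀ H g τ ρ₀ k =
      bondTrace ((stepMap B (collisionU H g τ) (collisionU H g τ)ᴴ)^[k]
        (bondProd (fun p : D × D => χ₀ p.1 p.2) ρ₀)) := by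
  rw [systemState, ptrace_mul_kronecker_mul, bondTrace_apply]
  simp_rw [iterate_stepMap_eq, mpdo_eq_bondRow, dotProduct_bondVec, Finset.sum_smul]
  symm
  rw [Finset.sum_comm]
  refine Finset.sum_congr rfl fun z _ => ?_
  rw [Finset.sum_comm]
  refine Finset.sum_congr rfl fun x _ => ?_
  rw [Finset.sum_comm]

end Step

/-! ### Stability of the first-order commutator step. -/

section OperatorNorm

open scoped Matrix.Norms.L2Operator MatrixOrder

variable {S : Type*} [Fintype S] [DecidableEq S]

theorem exists_eq_conjTranspose_mul_self {X : Matrix S S ℂ} (hX : X.PosSemidef) :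
    ∃ Y : Matrix S S ℂ, X = Yᴴ * Y :=
  CStarAlgebra.nonneg_iff_eq_star_mul_self.mp (Matrix.nonneg_iff_posSemidef.2 hX)

/-- Up to ε² h X h the step is the conjugation V* X V by V = 1 + iεh, and V* V = 1 + ε² h² has no
first-order term because h is Hermitian. A bound 1 + O(ε) would be useless over ε⁻² steps. -/
theorem norm_add_smul_commutator_le {h : Matrix S S ℂ} (hh : h.IsHermitian) (ε : ℝ)
    (X : Matrix S S ℂ) :
    ‖X + (ε : ℂ) • (-Complex.I) • ⁅h, X⁆‖ ≤ (1 + 2 * ‖h‖ ^ 2 * ε ^ 2) * ‖X‖ := by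
  set V : Matrix S S ℂ := 1 + ((ε : ℂ) * Complex.I) • h with hV
  have hVs : star V = 1 - ((ε : ℂ) * Complex.I) • h := by
    rw [hV, Matrix.star_eq_conjTranspose, Matrix.conjTranspose_add, Matrix.conjTranspose_smul,
      hh.eq, Matrix.conjTranspose_one]
    simp [sub_eq_add_neg]
  have hI : ((ε : ℂ) * Complex.I) * ((ε : ℂ) * Complex.I) = -(ε : ℂ) ^ 2 := by
    linear_combination (ε : ℂ) ^ 2 * Complex.I_mul_I
  have hVV : star V * V = 1 + (ε : ℂ) ^ 2 • (h * h) := by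
    rw [hVs, hV, sub_mul, mul_add, mul_add, one_mul, one_mul, mul_one, Matrix.smul_mul,
      Matrix.mul_smul, smul_smul, hI]
    module
  have hVn : ‖V‖ * ‖V‖ ≤ 1 + ‖h‖ ^ 2 * ε ^ 2 := by
    rw [← CStarRing.norm_star_mul_self, hVV]
    refine (norm_add_le _ _).trans ?_
    rw [norm_smul, norm_pow, Complex.norm_real, Real.norm_eq_abs, sq_abs]
    have h1 := Matrix.l2_opNorm_mul h h
    have h2 : ‖(1 : Matrix S S ℂ)‖ ≤ 1 := by
      have := CStarRing.norm_star_mul_self (x := (1 : Matrix S S ℂ))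
      rw [star_one, one_mul] at this
      nlinarith [norm_nonneg (1 : Matrix S S ℂ)]
    nlinarith [sq_nonneg ε]
  have hsplit : X + (ε : ℂ) • (-Complex.I) • ⁅h, X⁆ =
      star V * X * V - (ε : ℂ) ^ 2 • (h * X * h) := by
    rw [hVs, hV, Ring.lie_def, sub_mul, sub_mul, mul_add, mul_add, one_mul, mul_one, mul_one,
      Matrix.smul_mul, Matrix.smul_mul, Matrix.mul_smul, Matrix.mul_smul, smul_smul (_ * _) (_ * _) (h * X * h), hI]
    module
  have e1 : ‖star V * X * V‖ ≤ (1 + ‖h‖ ^ 2 * ε ^ 2) * ‖X‖ := by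
    calc ‖star V * X * V‖ ≤ ‖star V‖ * ‖X‖ * ‖V‖ :=
          (Matrix.l2_opNorm_mul _ _).trans (by gcongr; exact Matrix.l2_opNorm_mul _ _)
      _ = ‖V‖ * ‖V‖ * ‖X‖ := by rw [norm_star]; ring
      _ ≤ _ := by gcongr
  have e2 : ‖(ε : ℂ) ^ 2 • (h * X * h)‖ ≤ ‖h‖ ^ 2 * ε ^ 2 * ‖X‖ := by
    rw [norm_smul, norm_pow, Complex.norm_real, Real.norm_eq_abs, sq_abs]
    calc ε ^ 2 * ‖h * X * h‖ ≤ ε ^ 2 * (‖h‖ * ‖X‖ * ‖h‖) := by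
          gcongr
          exact (Matrix.l2_opNorm_mul _ _).trans (by gcongr; exact Matrix.l2_opNorm_mul _ _)
      _ = _ := by ring
  rw [hsplit]
  refine (norm_sub_le _ _).trans ((add_le_add e1 e2).trans (le_of_eq ?_))
  ring

end OperatorNorm

/-! ### Complete positivity, trace preservation and uniform bounds. -/

section Positivity

open scoped Matrix.Norms.Frobenius

variable {S A D β : Type*} [Fintype S] [DecidableEq S] [Fintype A] [DecidableEq A]
  [Fintype D] [DecidableEq D] [Fintype β] {n : ℕ}

theorem frobenius_norm_sq (X : Matrix S S ℂ) : ‖X‖ ^ 2 = ((Xᴴ * X).trace).re := by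
  rw [Matrix.frobenius_norm_def, ← Real.sqrt_eq_rpow, Real.sq_sqrt (by positivity),
    Matrix.trace, Complex.re_sum, Finset.sum_comm]
  refine Finset.sum_congr rfl fun j _ => ?_
  rw [Matrix.diag_apply, Matrix.mul_apply, Complex.re_sum]
  refine Finset.sum_congr rfl fun i _ => ?_
  rw [Matrix.conjTranspose_apply, Complex.star_def, ← Complex.normSq_eq_conj_mul_self,
    Complex.ofReal_re, Complex.normSq_eq_norm_sq]
  norm_num

/-- For X = Y* Y submultiplicativity gives ‖X‖ ≤ ‖Y‖², and ‖Y‖² is the trace of X. -/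
theorem frobenius_norm_le_trace {X : Matrix S S ℂ} (hX : X.PosSemidef) : ‖X‖ ≤ X.trace.re := by
  obtain ⟨Y, rfl⟩ := exists_eq_conjTranspose_mul_self hX
  rw [← frobenius_norm_sq, sq]
  refine (Matrix.frobenius_norm_mul _ _).trans ?_
  rw [Matrix.frobenius_norm_conjTranspose]

theorem norm_apply_le_trace {X : Matrix S S ℂ} (hX : X.PosSemidef) (i j : S) :
    ‖X i j‖ ≤ X.trace.re := by
  refine le_trans ?_ (frobenius_norm_le_trace hX)
  rw [Matrix.frobenius_norm_def, ← Real.sqrt_eq_rpow]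
  refine Real.le_sqrt_of_sq_le ?_
  simp only [Real.rpow_two]
  refine le_trans ?_ (Finset.single_le_sum (f := fun i => ∑ j, ‖X i j‖ ^ 2)
    (fun _ _ => by positivity) (Finset.mem_univ i))
  exact Finset.single_le_sum (f := fun j => ‖X i j‖ ^ 2)
    (fun _ _ => by positivity) (Finset.mem_univ j)

/-- The operator on the system and the bond collecting the components of `Z`. -/
def bondMatrix {S D : Type*} (Z : D × D → Matrix S S ℂ) : Matrix (S × D) (S × D) ℂ :=
  Matrix.of fun x y => Z (x.2, y.2) x.1 y.1

theorem blk_bondMatrix {S D : Type*} (Z : D × D → Matrix S S ℂ) (a b : D) :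
    blk (bondMatrix Z) a b = Z (a, b) := rfl

theorem ext_blk {S A : Type*} {X Y : Matrix (S × A) (S × A) ℂ}
    (h : ∀ i j, blk X i j = blk Y i j) : X = Y := by
  ext ⟨s, i⟩ ⟨s', j⟩
  exact congrFun (congrFun (h i j) s) s'

theorem blk_sum {S A ι : Type*} (s : Finset ι) (X : ι → Matrix (S × A) (S × A) ℂ) (i j : A) :
    blk (∑ k ∈ s, X k) i j = ∑ k ∈ s, blk (X k) i j := by
  ext a b
  simp [blk, Matrix.sum_apply]

theorem mTensor_apply (B : β → A → Matrix D D ℂ) (i i' : A) (a c : D × D) :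
    mTensor B i i' a c = ∑ b, B b i a.1 c.1 * star (B b i' a.2 c.2) := by
  simp [mTensor, Matrix.sum_apply]

/-- The Kraus operators of a collision. -/
def krausOp (B : β → A → Matrix D D ℂ) (U : Matrix (S × A) (S × A) ℂ) (b : β) (j : A) :
    Matrix (S × D) (S × D) ℂ :=
  Matrix.of fun x y => ∑ i, B b i y.2 x.2 * U (x.1, j) (y.1, i)

theorem blk_krausOp (B : β → A → Matrix D D ℂ) (U : Matrix (S × A) (S × A) ℂ) (b : β) (j : A)
    (c a : D) : blk (krausOp B U b j) c a = ∑ i, B b i a c • blk U j i := by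
  ext s s'
  simp [blk, krausOp, Matrix.sum_apply]

/-- This is a Kraus decomposition: the sum over b inside `mTensor` together with the traced ancilla
index j labels the Kraus operators. The bond indices of B enter transposed because the bond state is
a row vector. -/
theorem bondMatrix_stepMap (B : β → A → Matrix D D ℂ) (U : Matrix (S × A) (S × A) ℂ)
    (Z : D × D → Matrix S S ℂ) :
    bondMatrix (stepMap B U Uᴴ Z) =
      ∑ b, ∑ j, krausOp B U b j * bondMatrix Z * (krausOp B U b j)ᴴ := by
  refine ext_blk fun c c' => ?_
  simp_rw [blk_sum, blk_mul, blk_conjTranspose, blk_krausOp, blk_bondMatrix, stepMap_apply,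
    mTensor_apply, Matrix.conjTranspose_sum, Matrix.conjTranspose_smul, Finset.sum_mul,
    Finset.mul_sum, Finset.sum_smul, Fintype.sum_prod_type]
  simp only [← Fintype.sum_prod_type']
  refine Fintype.sum_equiv
    ⟨fun p => (p.2.2.2.2.2, p.2.2.1, p.2.1, p.1, p.2.2.2.1, p.2.2.2.2.1),
      fun q => (q.2.2.2.1, q.2.2.1, q.2.1, q.2.2.2.2.1, q.2.2.2.2.2, q.1),
      fun _ => rfl, fun _ => rfl⟩ _ _ fun p => ?_
  simp [Matrix.smul_mul, Matrix.mul_smul, smul_smul, mul_comm, blk_conjTranspose]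

theorem posSemidef_bondMatrix_stepMap (B : β → A → Matrix D D ℂ) (U : Matrix (S × A) (S × A) ℂ)
    {Z : D × D → Matrix S S ℂ} (hZ : (bondMatrix Z).PosSemidef) :
    (bondMatrix (stepMap B U Uᴴ Z)).PosSemidef := by
  rw [bondMatrix_stepMap]
  exact Matrix.posSemidef_sum _ fun b _ => Matrix.posSemidef_sum _ fun j _ =>
    hZ.mul_mul_conjTranspose_same _

theorem trace_bondMatrix (Z : D × D → Matrix S S ℂ) :
    (bondMatrix Z).trace = (bondTrace Z).trace := by
  rw [bondTrace_apply, Matrix.trace_sum, Matrix.trace, Fintype.sum_prod_type, Finset.sum_comm]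
  rfl

theorem transfer_mulVec_bondVec {B : β → A → Matrix D D ℂ} (hB : RightNormalized B) :
    transfer B *ᵥ bondVec = bondVec := by
  ext ⟨a, a'⟩
  have h1 := congrFun (congrFun hB a) a'
  simp only [Matrix.sum_apply, Matrix.mul_apply, Matrix.conjTranspose_apply] at h1
  rw [mulVec_bondVec]
  simp_rw [transfer, Matrix.sum_apply, mTensor_apply]
  rw [bondVec, ← Matrix.one_apply, ← h1, Finset.sum_comm]
  simp_rw [Finset.sum_comm (s := (Finset.univ : Finset D))]
  rw [Finset.sum_comm]

theorem bondTrace_stepMap (B : β → A → Matrix D D ℂ) (X Y : Matrix (S × A) (S × A) ℂ)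
    (Z : D × D → Matrix S S ℂ) :
    bondTrace (stepMap B X Y Z) = ∑ a, ∑ j, ∑ i, ∑ i', (mTensor B i i' *ᵥ bondVec) a •
      (blk X j i * Z a * blk Y i' j) := by
  simp_rw [bondTrace_apply, stepMap_apply, mulVec_bondVec, Finset.sum_smul]
  rw [Finset.sum_comm]
  refine Finset.sum_congr rfl fun a _ => ?_
  rw [Finset.sum_comm]
  refine Finset.sum_congr rfl fun j _ => ?_
  rw [Finset.sum_comm]
  refine Finset.sum_congr rfl fun i _ => ?_
  rw [Finset.sum_comm]

/-- Cyclicity of the trace and U†U = 1 force i = i', so the tensors sum to the transfer matrix,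
which fixes `bondVec` by right normalization. -/
theorem trace_bondTrace_stepMap {B : β → A → Matrix D D ℂ} (hB : RightNormalized B)
    {U : Matrix (S × A) (S × A) ℂ} (hU : Uᴴ * U = 1) (Z : D × D → Matrix S S ℂ) :
    (bondTrace (stepMap B U Uᴴ Z)).trace = (bondTrace Z).trace := by
  have h1 : ∀ i i' : A, ∑ j, (blk Uᴴ i' j * blk U j i) = if i' = i then 1 else 0 := by
    intro i i'
    rw [← blk_mul, hU, blk_one]
  have h2 : ∀ a : D × D, ∑ j, ∑ i, ∑ i', (mTensor B i i' *ᵥ bondVec) a •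
      (blk U j i * Z a * blk Uᴴ i' j).trace = (transfer B *ᵥ bondVec) a • (Z a).trace := by
    intro a
    have h3 : ∀ i i' j, (blk U j i * Z a * blk Uᴴ i' j).trace =
        ((blk Uᴴ i' j * blk U j i) * Z a).trace := by
      intro i i' j
      rw [Matrix.trace_mul_comm, Matrix.mul_assoc]
    simp_rw [h3]
    rw [Finset.sum_comm]
    have h4 : ∀ i : A, ∑ j, ∑ i', (mTensor B i i' *ᵥ bondVec) a •
        (blk Uᴴ i' j * blk U j i * Z a).trace = (mTensor B i i *ᵥ bondVec) a • (Z a).trace := by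
      intro i
      rw [Finset.sum_comm]
      have h5 : ∀ i' : A, ∑ j, (mTensor B i i' *ᵥ bondVec) a •
          (blk Uᴴ i' j * blk U j i * Z a).trace =
          if i' = i then (mTensor B i i' *ᵥ bondVec) a • (Z a).trace else 0 := by
        intro i'
        rw [← Finset.smul_sum, ← Matrix.trace_sum, ← Finset.sum_mul, h1]
        split_ifs <;> simp
      rw [Finset.sum_congr rfl fun i' _ => h5 i']
      simp
    rw [Finset.sum_congr rfl fun i _ => h4 i, ← Finset.sum_smul, transfer, Matrix.sum_mulVec,
      Finset.sum_apply]
  rw [bondTrace_stepMap]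
  simp_rw [Matrix.trace_sum, Matrix.trace_smul]
  simp_rw [h2, transfer_mulVec_bondVec hB]
  rw [bondTrace_apply, Matrix.trace_sum, ← dotProduct_bondVec fun a => (Z a).trace, dotProduct]
  simp_rw [smul_eq_mul, mul_comm]

/-- Every iterate is a density matrix of system and bond, and the entries of a positive matrix are
bounded by its trace. -/
theorem norm_iterate_stepMap_apply_le {B : β → A → Matrix D D ℂ} (hB : RightNormalized B)
    {χ₀ : Matrix D D ℂ} (hχ₀ : IsDensity χ₀) {ρ₀ : Matrix S S ℂ} (hρ₀ : IsDensity ρ₀)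
    {U : Matrix (S × A) (S × A) ℂ} (hU : Uᴴ * U = 1) (k : ℕ) (c : D × D) (s s' : S) :
    ‖(stepMap B U Uᴴ)^[k] (bondProd (fun p : D × D => χ₀ p.1 p.2) ρ₀) c s s'‖ ≤ 1 := by
  set Z₀ : D × D → Matrix S S ℂ := bondProd (fun p : D × D => χ₀ p.1 p.2) ρ₀ with hZ₀
  have h0 : bondMatrix Z₀ = ρ₀ ⊗ₖ χ₀ := by
    ext ⟨s, a⟩ ⟨s', a'⟩
    simp [bondMatrix, hZ₀, bondProd_apply, mul_comm]
  have h1 : (bondMatrix ((stepMap B U Uᴴ)^[k] Z₀)).PosSemidef ∧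
      (bondMatrix ((stepMap B U Uᴴ)^[k] Z₀)).trace = 1 := by
    induction k with
    | zero =>
      rw [Function.iterate_zero, id, h0, Matrix.trace_kronecker, hρ₀.2, hχ₀.2, one_mul]
      exact ⟨hρ₀.1.kronecker hχ₀.1, rfl⟩
    | succ k ih =>
      rw [Function.iterate_succ_apply']
      refine ⟨posSemidef_bondMatrix_stepMap B U ih.1, ?_⟩
      rw [trace_bondMatrix, trace_bondTrace_stepMap hB hU, ← trace_bondMatrix, ih.2]
  have h2 := norm_apply_le_trace h1.1 (s, c.1) (s', c.2)
  rwa [h1.2, Complex.one_re] at h2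

theorem collisionU_conjTranspose {H : Matrix (S × A) (S × A) ℂ} (hH : H.IsHermitian) (g τ : ℝ) :
    (collisionU H g τ)ᴴ = NormedSpace.exp ((Complex.I * ((g * τ : ℝ) : ℂ)) • H) := by
  rw [collisionU, ← Matrix.exp_conjTranspose, Matrix.conjTranspose_smul, hH.eq]
  congr 2
  simp

theorem collisionU_conjTranspose_mul_self {H : Matrix (S × A) (S × A) ℂ} (hH : H.IsHermitian)
    (g τ : ℝ) : (collisionU H g τ)ᴴ * collisionU H g τ = 1 := by
  rw [collisionU_conjTranspose hH, collisionU, neg_smul,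
    ← Matrix.exp_add_of_commute _ _ (Commute.refl ((Complex.I * ((g * τ : ℝ) : ℂ)) • H)).neg_right, add_neg_cancel,
    NormedSpace.exp_zero]

end Positivity

/-! ### Reduced ancilla states as transfer-matrix contractions. -/

section ReducedStates

variable {A D β : Type*} [Fintype A] [DecidableEq A]
  [Fintype D] [DecidableEq D] [Fintype β] {n : ℕ}

/-- A weight that factorizes over the sites can be absorbed into the tensors site by site. -/
theorem sum_weight_bondRow (B : β → A → Matrix D D ℂ) (χ₀ : Matrix D D ℂ)
    (f : Fin n → A → A → ℂ) :
    ∑ x : Fin n → A, ∑ y : Fin n → A, (∏ m, f m (x m) (y m)) • bondRow B χ₀ x y =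
      (fun p : D × D => χ₀ p.1 p.2) ᵥ*
        (List.ofFn fun m => ∑ i, ∑ i', f m i i' • mTensor B i i').prod := by
  induction n with
  | zero => simp [bondRow]
  | succ n ih =>
    rw [List.ofFn_succ', List.concat_eq_append, List.prod_append, List.prod_singleton,
      ← Matrix.vecMul_vecMul, ← ih]
    simp_rw [sum_snoc, Fin.prod_univ_castSucc, Fin.snoc_castSucc, Fin.snoc_last, bondRow_snoc,
      Matrix.sum_vecMul, Matrix.vecMul_sum, Matrix.vecMul_smul, Matrix.smul_vecMul, smul_smul]
    simp only [← Fintype.sum_prod_type']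
    refine Fintype.sum_equiv
      ⟨fun p => (p.2.1, p.2.2.2, p.1, p.2.2.1), fun q => (q.2.2.1, q.1, q.2.2.2, q.2.1),
        fun _ => rfl, fun _ => rfl⟩ _ _ fun p => ?_
    simp [mul_comm]

open Classical in
theorem sum_constrained_mpdo (B : β → A → Matrix D D ℂ) (χ₀ : Matrix D D ℂ)
    (P : Fin n → A → A → Prop) :
    ∑ x : Fin n → A, ∑ y : Fin n → A,
      (if ∀ m, P m (x m) (y m) then mpdo B χ₀ n x y else 0) =
      (fun p : D × D => χ₀ p.1 p.2) ᵥ*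
        (List.ofFn fun m => ∑ i, ∑ i', if P m i i' then mTensor B i i' else 0).prod ⬝ᵥ bondVec := by
  have h1 := sum_weight_bondRow B χ₀ (fun m i i' => if P m i i' then 1 else 0)
  simp only [ite_smul, one_smul, zero_smul] at h1
  rw [← h1, sum_dotProduct]
  refine Finset.sum_congr rfl fun x _ => ?_
  rw [sum_dotProduct]
  refine Finset.sum_congr rfl fun y _ => ?_
  rw [mpdo_eq_bondRow, Finset.prod_boole]
  by_cases h : ∀ m, P m (x m) (y m) <;> simp [h]

theorem prod_range_of_const {M : Type*} [Monoid M] {c : ℕ → M} {T : M} {a r : ℕ}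
    (h : ∀ k, a ≤ k → k < a + r → c k = T) :
    ((List.range (a + r)).map c).prod = ((List.range a).map c).prod * T ^ r := by
  induction r with
  | zero => simp
  | succ r ih =>
    rw [← add_assoc, List.prod_range_succ, ih fun k h1 h2 => h k h1 (by omega),
      h _ (by omega) (by omega), pow_succ, mul_assoc]

theorem transfer_pow_mulVec_bondVec {B : β → A → Matrix D D ℂ} (hB : RightNormalized B) (r : ℕ) :
    transfer B ^ r *ᵥ bondVec = bondVec := by
  induction r with
  | zero => simp
  | succ r ih => rw [pow_succ, ← Matrix.mulVec_mulVec, transfer_mulVec_bondVec hB, ih]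

theorem list_ofFn_eq_map_range {M : Type*} (c : ℕ → M) (n : ℕ) :
    (List.ofFn fun k : Fin n => c k) = (List.range n).map c := by
  rw [List.ofFn_eq_map, ← List.map_coe_finRange_eq_range, List.map_map]
  rfl

theorem siteState_mpdo {B : β → A → Matrix D D ℂ} (hB : RightNormalized B)
    (χ₀ : Matrix D D ℂ) (l : Fin n) (i i' : A) :
    siteState (mpdo B χ₀ n) l i i' =
      (fun p : D × D => χ₀ p.1 p.2) ᵥ* transfer B ^ (l : ℕ) ⬝ᵥ mTensor B i i' *ᵥ bondVec := by
  classical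
  -- The partial trace is encoded as a sitewise constraint: prescribed indices at l and equal row
  -- and column indices elsewhere. A free site thus contributes the transfer matrix.
  obtain ⟨P, hP⟩ : ∃ P : Fin n → A → A → Prop, ∀ m a b, P m a b ↔
      (m = l → a = i ∧ b = i') ∧ (m ≠ l → a = b) := ⟨_, fun _ _ _ => Iff.rfl⟩
  have h1 := sum_constrained_mpdo B χ₀ P
  have h2 : siteState (mpdo B χ₀ n) l i i' = ∑ x : Fin n → A, ∑ y : Fin n → A,
      (if ∀ m, P m (x m) (y m) then mpdo B χ₀ n x y else 0) := by
    rw [siteState, Matrix.of_apply]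
    refine Finset.sum_congr rfl fun x _ => ?_
    have h3 : ∀ y : Fin n → A, (∀ m, P m (x m) (y m)) ↔
        (Function.update x l i' = y ∧ x l = i) := by
      intro y
      simp only [hP]
      rw [Function.update_eq_iff]
      constructor
      · intro h
        exact ⟨⟨((h l).1 rfl).2.symm, fun m hm => (h m).2 hm⟩, ((h l).1 rfl).1⟩
      · rintro ⟨⟨h1, h2⟩, h3⟩ m
        exact ⟨by rintro rfl; exact ⟨h3, h1.symm⟩, fun hm => h2 m hm⟩
    simp_rw [h3, ite_and, Finset.sum_ite_eq, Finset.mem_univ, if_true]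
  set c : ℕ → Matrix (D × D) (D × D) ℂ := fun k => if k = l then mTensor B i i' else transfer B
    with hc
  have h4 : ∀ m : Fin n, (∑ a, ∑ b, if P m a b then mTensor B a b else 0) = c m := by
    intro m
    simp_rw [hP]
    by_cases hm : m = l
    · simp [hm, ite_and, hc]
    · have : (m : ℕ) ≠ l := fun h => hm (Fin.ext h)
      simp [hm, this, transfer, hc]
  simp_rw [h4] at h1
  rw [list_ofFn_eq_map_range] at h1
  rw [h2, h1]
  -- The r ancillas to the right of l contribute T^r, which is absorbed by `bondVec`; those to the
  -- left leave T^l acting on χ₀.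
  obtain ⟨r, hr⟩ : ∃ r, n = (l + 1) + r := ⟨n - (l + 1), by omega⟩
  have h5 := prod_range_of_const (c := c)
    (T := transfer B) (a := l + 1) (r := r) (fun k h1 _ => if_neg (by omega))
  have h6 := prod_range_of_const (c := c)
    (T := transfer B) (a := 0) (r := l) (fun k _ h1 => if_neg (by omega))
  rw [zero_add] at h6
  conv_lhs => rw [hr]
  rw [h5, List.prod_range_succ, h6, show c l = mTensor B i i' from if_pos rfl, List.range_zero, List.map_nil, List.prod_nil,
    one_mul, ← Matrix.vecMul_vecMul, ← Matrix.dotProduct_mulVec, transfer_pow_mulVec_bondVec hB,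
    ← Matrix.vecMul_vecMul, ← Matrix.dotProduct_mulVec]

theorem pairState_mpdo {B : β → A → Matrix D D ℂ} (hB : RightNormalized B)
    (χ₀ : Matrix D D ℂ) (l k : Fin n) (s : ℕ) (hk : (k : ℕ) = l + s + 1) (i i' : A × A) :
    pairState (mpdo B χ₀ n) l k i i' =
      (fun p : D × D => χ₀ p.1 p.2) ᵥ* transfer B ^ (l : ℕ) ⬝ᵥ
        (mTensor B i.1 i'.1 * transfer B ^ s * mTensor B i.2 i'.2) *ᵥ bondVec := by
  classical
  have hlk : l ≠ k := fun h => by rw [h] at hk; omega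
  obtain ⟨P, hP⟩ : ∃ P : Fin n → A → A → Prop, ∀ m a b, P m a b ↔ (m = l → a = i.1 ∧ b = i'.1) ∧
    (m = k → a = i.2 ∧ b = i'.2) ∧ (m ≠ l → m ≠ k → a = b) := ⟨_, fun _ _ _ => Iff.rfl⟩
  have h1 := sum_constrained_mpdo B χ₀ P
  have h2 : pairState (mpdo B χ₀ n) l k i i' = ∑ x : Fin n → A, ∑ y : Fin n → A,
      (if ∀ m, P m (x m) (y m) then mpdo B χ₀ n x y else 0) := by
    rw [pairState, Matrix.of_apply]
    refine Finset.sum_congr rfl fun x _ => ?_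
    have h3 : ∀ y : Fin n → A, (∀ m, P m (x m) (y m)) ↔
        (Function.update (Function.update x l i'.1) k i'.2 = y ∧ (x l = i.1 ∧ x k = i.2)) := by
      intro y
      simp only [hP]
      rw [Function.update_eq_iff]
      constructor
      · intro h
        refine ⟨⟨((h k).2.1 rfl).2.symm, fun m hm => ?_⟩, ((h l).1 rfl).1, ((h k).2.1 rfl).1⟩
        by_cases hml : m = l
        · subst hml
          rw [Function.update_self, ((h m).1 rfl).2]
        · rw [Function.update_of_ne hml, (h m).2.2 hml hm]
      · rintro ⟨⟨h1, h2⟩, h3, h4⟩ m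
        refine ⟨?_, ?_, fun hm hm' => ?_⟩
        · rintro rfl
          have := h2 m hlk
          rw [Function.update_self] at this
          exact ⟨h3, this.symm⟩
        · rintro rfl
          exact ⟨h4, h1.symm⟩
        · have := h2 m hm'
          rwa [Function.update_of_ne hm] at this
    simp_rw [h3]
    have h4 : ∀ y : Fin n → A, (if Function.update (Function.update x l i'.1) k i'.2 = y ∧
        (x l = i.1 ∧ x k = i.2) then mpdo B χ₀ n x y else 0) =
        if Function.update (Function.update x l i'.1) k i'.2 = y then
          if x l = i.1 ∧ x k = i.2 then mpdo B χ₀ n x y else 0 else 0 := fun y => ite_and ..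
    simp_rw [h4, Finset.sum_ite_eq, Finset.mem_univ, if_true]
  set c : ℕ → Matrix (D × D) (D × D) ℂ := fun m => if m = l then mTensor B i.1 i'.1 else
    if m = k then mTensor B i.2 i'.2 else transfer B with hc
  have h4 : ∀ m : Fin n, (∑ a, ∑ b, if P m a b then
      mTensor B a b else 0) = c m := by
    intro m
    simp_rw [hP]
    by_cases hm : m = l
    · simp [hm, ite_and, hlk, hc]
    · have hm1 : (m : ℕ) ≠ l := fun h => hm (Fin.ext h)
      by_cases hm' : m = k
      · simp [hm', ite_and, hlk.symm, hc, show (k : ℕ) ≠ l by omega]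
      · have hm1' : (m : ℕ) ≠ k := fun h => hm' (Fin.ext h)
        simp [hm, hm', hm1, hm1', transfer, hc]
  simp_rw [h4] at h1
  rw [list_ofFn_eq_map_range] at h1
  rw [h2, h1]
  obtain ⟨r, hr⟩ : ∃ r, n = ((l + 1) + s + 1) + r := ⟨n - ((l + 1) + s + 1), by omega⟩
  have h5 := prod_range_of_const (c := c) (T := transfer B) (a := (l + 1) + s + 1) (r := r)
    (fun m h1 _ => by rw [hc]; simp only; rw [if_neg (by omega), if_neg (by omega)])
  have h6 := prod_range_of_const (c := c) (T := transfer B) (a := l + 1) (r := s)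
    (fun m h1 _ => by rw [hc]; simp only; rw [if_neg (by omega), if_neg (by omega)])
  have h7 := prod_range_of_const (c := c) (T := transfer B) (a := 0) (r := l)
    (fun m h1 _ => by rw [hc]; simp only; rw [if_neg (by omega), if_neg (by omega)])
  have h8 : c l = mTensor B i.1 i'.1 := if_pos rfl
  have h9 : c (l + 1 + s) = mTensor B i.2 i'.2 := by
    rw [hc]; simp only; rw [if_neg (by omega), if_pos (by omega)]
  rw [zero_add] at h7
  conv_lhs => rw [hr]
  rw [h5, List.prod_range_succ, h6, List.prod_range_succ, h7, h8, h9, List.range_zero, List.map_nil,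
    List.prod_nil, one_mul, ← Matrix.vecMul_vecMul, ← Matrix.dotProduct_mulVec,
    transfer_pow_mulVec_bondVec hB, Matrix.mul_assoc, Matrix.mul_assoc, ← Matrix.vecMul_vecMul,
    ← Matrix.dotProduct_mulVec, Matrix.mul_assoc]

theorem bondVec_ne_zero {χ₀ : Matrix D D ℂ} (hχ₀ : IsDensity χ₀) :
    (bondVec : D × D → ℂ) ≠ 0 := by
  intro h
  have h1 : ∀ d : D, False := fun d => by
    have := congrFun h (d, d)
    simp [bondVec] at this
  have h2 := hχ₀.2
  rw [Matrix.trace, Finset.sum_eq_zero fun d _ => (h1 d).elim] at h2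
  exact zero_ne_one h2

/-- Any initial bond state of unit trace relaxes to w. -/
theorem tendsto_vecMul_transfer_pow {B : β → A → Matrix D D ℂ} {χ₀ : Matrix D D ℂ}
    (hχ₀ : IsDensity χ₀) {w : D × D → ℂ}
    (hw : Tendsto (fun m : ℕ => transfer B ^ m) atTop (𝓝 (Matrix.vecMulVec bondVec w))) :
    Tendsto (fun m : ℕ => (fun p : D × D => χ₀ p.1 p.2) ᵥ* transfer B ^ m) atTop (𝓝 w) := by
  have h1 : Continuous fun N : Matrix (D × D) (D × D) ℂ => (fun p : D × D => χ₀ p.1 p.2) ᵥ* N :=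
    continuous_const.matrix_vecMul continuous_id
  have h2 := (h1.tendsto _).comp hw
  have h3 : (fun p : D × D => χ₀ p.1 p.2) ᵥ* Matrix.vecMulVec bondVec w = w := by
    rw [Matrix.vecMul_vecMulVec, dotProduct_bondVec]
    have : ∑ d, χ₀ d d = 1 := hχ₀.2
    rw [this]
    simp
  rw [h3] at h2
  exact h2

/-- χ₀ itself need not be stationary. Homogeneity allows the site to be shifted by any l, and l → ∞
replaces χ₀ by w. -/
theorem anc1_eq {B : β → A → Matrix D D ℂ} (hB : RightNormalized B) {χ₀ : Matrix D D ℂ}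
    (hχ₀ : IsDensity χ₀) (hhom : IsHomogeneous B χ₀) {w : D × D → ℂ}
    (hw : Tendsto (fun m : ℕ => transfer B ^ m) atTop (𝓝 (Matrix.vecMulVec bondVec w)))
    (i i' : A) : anc1 B χ₀ i i' = w ⬝ᵥ mTensor B i i' *ᵥ bondVec := by
  have h1 : ∀ l : ℕ, anc1 B χ₀ i i' =
      (fun p : D × D => χ₀ p.1 p.2) ᵥ* transfer B ^ l ⬝ᵥ mTensor B i i' *ᵥ bondVec := by
    intro l
    have h2 := hhom.1 (l + 1) 0 (Fin.last l)
    have h3 := siteState_mpdo hB χ₀ (Fin.last l) i i'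
    rw [← h2, siteState_mpdo hB] at h3
    rw [anc1, siteState_mpdo hB]
    exact h3
  have h2 : Continuous fun v : D × D → ℂ => v ⬝ᵥ mTensor B i i' *ᵥ bondVec :=
    continuous_id.dotProduct continuous_const
  have h3 := (h2.tendsto _).comp (tendsto_vecMul_transfer_pow hχ₀ hw)
  exact tendsto_nhds_unique (tendsto_const_nhds.congr h1) h3

theorem anc2_eq {B : β → A → Matrix D D ℂ} (hB : RightNormalized B) {χ₀ : Matrix D D ℂ}
    (hχ₀ : IsDensity χ₀) (hhom : IsHomogeneous B χ₀) {w : D × D → ℂ}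
    (hw : Tendsto (fun m : ℕ => transfer B ^ m) atTop (𝓝 (Matrix.vecMulVec bondVec w)))
    (s : ℕ) (i i' : A × A) : anc2 B χ₀ (s + 1) i i' =
      w ⬝ᵥ (mTensor B i.1 i'.1 * transfer B ^ s * mTensor B i.2 i'.2) *ᵥ bondVec := by
  have h1 : ∀ l : ℕ, anc2 B χ₀ (s + 1) i i' =
      (fun p : D × D => χ₀ p.1 p.2) ᵥ* transfer B ^ l ⬝ᵥ
        (mTensor B i.1 i'.1 * transfer B ^ s * mTensor B i.2 i'.2) *ᵥ bondVec := by
    intro l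
    -- In a chain of l + s + 2 ancillas the pairs (0, s + 1) and (l, l + s + 1) are equally far
    -- apart.
    have h2 := hhom.2 (l + s + 1 + 1) 0 ⟨s + 1, by omega⟩ ⟨l, by omega⟩ (Fin.last _)
      (by simp [Fin.lt_def]) (by simp [Fin.lt_def]) (by simp; omega)
    have h3 := pairState_mpdo hB χ₀ (n := l + s + 1 + 1) ⟨l, by omega⟩ (Fin.last _) s
      (by simp) i i'
    rw [← h2, pairState_mpdo hB χ₀ _ _ s (by simp)] at h3
    rw [anc2, pairState_mpdo hB χ₀ _ _ s (by simp)]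
    exact h3
  have h2 : Continuous fun v : D × D → ℂ => v ⬝ᵥ
      (mTensor B i.1 i'.1 * transfer B ^ s * mTensor B i.2 i'.2) *ᵥ bondVec :=
    continuous_id.dotProduct continuous_const
  have h3 := (h2.tendsto _).comp (tendsto_vecMul_transfer_pow hχ₀ hw)
  exact tendsto_nhds_unique (tendsto_const_nhds.congr h1) h3

end ReducedStates

/-! ### Identification of the perturbative terms with the physical generators. -/

section Moments

variable {S A D β : Type*} [Fintype S] [DecidableEq S] [Fintype A] [DecidableEq A]
  [Fintype D] [DecidableEq D] [Fintype β] {n : ℕ}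

/-- The action of a matrix on the bond indices. -/
def bondMul : Matrix (D × D) (D × D) ℂ →ₗ[ℂ] (D × D → Matrix S S ℂ) →ₗ[ℂ] (D × D → Matrix S S ℂ) :=
  LinearMap.mk₂ ℂ (fun N Z c => ∑ a, N a c • Z a)
    (fun N N' Z => by
      refine funext fun c => ?_
      simp [add_smul, Finset.sum_add_distrib])
    (fun r N Z => by
      refine funext fun c => ?_
      simp [Finset.smul_sum, smul_smul])
    (fun N Z Z' => by
      refine funext fun c => ?_
      simp [smul_add, Finset.sum_add_distrib])
    (fun r N Z => by
      refine funext fun c => ?_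
      simp [Finset.smul_sum, smul_comm r])

theorem bondMul_apply (N : Matrix (D × D) (D × D) ℂ) (Z : D × D → Matrix S S ℂ) (c : D × D) :
    bondMul N Z c = ∑ a, N a c • Z a := rfl

theorem bondMul_one (Z : D × D → Matrix S S ℂ) : bondMul 1 Z = Z := by
  refine funext fun c => ?_
  simp [bondMul_apply, Matrix.one_apply]

theorem bondMul_mul (N N' : Matrix (D × D) (D × D) ℂ) (Z : D × D → Matrix S S ℂ) :
    bondMul (N * N') Z = bondMul N' (bondMul N Z) := by
  refine funext fun c => ?_
  simp_rw [bondMul_apply, Matrix.mul_apply, Finset.sum_smul, Finset.smul_sum, smul_smul]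
  rw [Finset.sum_comm]
  simp_rw [mul_comm]

theorem bondMul_vecMulVec (w : D × D → ℂ) (Z : D × D → Matrix S S ℂ) :
    bondMul (Matrix.vecMulVec bondVec w) Z = bondProd w (bondTrace Z) := by
  refine funext fun c => ?_
  rw [bondMul_apply, bondProd_apply, bondTrace_apply, Finset.smul_sum, Fintype.sum_prod_type]
  simp [Matrix.vecMulVec_apply, bondVec]

theorem bondMul_bondProd (N : Matrix (D × D) (D × D) ℂ) (v : D × D → ℂ) (X : Matrix S S ℂ) :
    bondMul N (bondProd v X) = bondProd (v ᵥ* N) X := by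
  refine funext fun c => ?_
  simp_rw [bondMul_apply, bondProd_apply, Matrix.vecMul, dotProduct, Finset.sum_smul, smul_smul,
    mul_comm]

theorem bondTrace_bondProd (v : D × D → ℂ) (X : Matrix S S ℂ) :
    bondTrace (bondProd v X) = (v ⬝ᵥ bondVec) • X := by
  simp_rw [bondTrace_apply, bondProd_apply, dotProduct_bondVec, Finset.sum_smul]

theorem bondTrace_bondMul {N : Matrix (D × D) (D × D) ℂ} (hN : N *ᵥ bondVec = bondVec)
    (Z : D × D → Matrix S S ℂ) : bondTrace (bondMul N Z) = bondTrace Z := by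
  simp_rw [bondTrace_apply, bondMul_apply]
  rw [Finset.sum_comm]
  simp_rw [← Finset.sum_smul, ← mulVec_bondVec, hN, Fintype.sum_prod_type]
  simp [bondVec]

theorem stepMap_one_one (B : β → A → Matrix D D ℂ) :
    stepMap (S := S) B 1 1 = bondMul (transfer B) := by
  refine LinearMap.ext fun Z => funext fun c => ?_
  rw [stepMap_apply, bondMul_apply]
  refine Finset.sum_congr rfl fun a _ => ?_
  simp [blk_one, transfer, Matrix.sum_apply, Finset.sum_smul]

theorem stepMap_bondProd (B : β → A → Matrix D D ℂ) (X Y : Matrix (S × A) (S × A) ℂ)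
    (v : D × D → ℂ) (ρ : Matrix S S ℂ) :
    stepMap B X Y (bondProd v ρ) =
      ∑ j, ∑ i, ∑ i', bondProd (v ᵥ* mTensor B i i') (blk X j i * ρ * blk Y i' j) := by
  refine funext fun c => ?_
  simp_rw [Finset.sum_apply, stepMap_apply, bondProd_apply, Matrix.vecMul, dotProduct,
    Finset.sum_smul, Matrix.mul_smul, Matrix.smul_mul, smul_smul]
  rw [Finset.sum_comm]
  refine Finset.sum_congr rfl fun j _ => ?_
  rw [Finset.sum_comm]
  refine Finset.sum_congr rfl fun i _ => ?_
  rw [Finset.sum_comm]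
  simp_rw [mul_comm]

theorem bondTrace_stepMap_bondProd (B : β → A → Matrix D D ℂ) (X Y : Matrix (S × A) (S × A) ℂ)
    (v : D × D → ℂ) (ρ : Matrix S S ℂ) {ω : Matrix A A ℂ}
    (hω : ∀ i i', ω i i' = v ⬝ᵥ mTensor B i i' *ᵥ bondVec) :
    bondTrace (stepMap B X Y (bondProd v ρ)) = ptrace (X * (ρ ⊗ₖ ω) * Y) := by
  rw [stepMap_bondProd, ptrace_mul_kronecker_mul]
  simp_rw [map_sum, bondTrace_bondProd, hω, Matrix.dotProduct_mulVec]

/-- The first-order part of the joint evolution of the system and of the bond. -/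
def stepMap₁ (B : β → A → Matrix D D ℂ) (H : Matrix (S × A) (S × A) ℂ) :
    (D × D → Matrix S S ℂ) →ₗ[ℂ] (D × D → Matrix S S ℂ) :=
  stepMap B ((-Complex.I) • H) 1 + stepMap B 1 (Complex.I • H)

/-- The second-order part of the joint evolution of the system and of the bond. -/
def stepMap₂ (B : β → A → Matrix D D ℂ) (H : Matrix (S × A) (S × A) ℂ) :
    (D × D → Matrix S S ℂ) →ₗ[ℂ] (D × D → Matrix S S ℂ) :=
  stepMap B (-(1 / 2 : ℂ) • (H * H)) 1 + stepMap B 1 (-(1 / 2 : ℂ) • (H * H)) +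
    stepMap B ((-Complex.I) • H) (Complex.I • H)

theorem stepMap₁_bondProd (B : β → A → Matrix D D ℂ) (H : Matrix (S × A) (S × A) ℂ)
    (v : D × D → ℂ) (ρ : Matrix S S ℂ) :
    stepMap₁ B H (bondProd v ρ) =
      ∑ i, ∑ i', bondProd (v ᵥ* mTensor B i i') ((-Complex.I) • ⁅blk H i' i, ρ⁆) := by
  have h1 : stepMap B ((-Complex.I) • H) 1 (bondProd v ρ) =
      ∑ i, ∑ i', bondProd (v ᵥ* mTensor B i i') ((-Complex.I) • (blk H i' i * ρ)) := by
    rw [stepMap_bondProd, Finset.sum_comm]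
    refine Finset.sum_congr rfl fun i _ => ?_
    rw [Finset.sum_comm]
    refine Finset.sum_congr rfl fun i' _ => ?_
    simp [blk_one, blk_smul, apply_ite, -neg_smul]
  have h2 : stepMap B 1 (Complex.I • H) (bondProd v ρ) =
      ∑ i, ∑ i', bondProd (v ᵥ* mTensor B i i') (Complex.I • (ρ * blk H i' i)) := by
    rw [stepMap_bondProd, Finset.sum_comm]
    refine Finset.sum_congr rfl fun i _ => ?_
    rw [Finset.sum_comm]
    refine Finset.sum_congr rfl fun i' _ => ?_
    simp [blk_one, blk_smul, apply_ite, ite_mul]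
  rw [stepMap₁, LinearMap.add_apply, h1, h2, ← Finset.sum_add_distrib]
  refine Finset.sum_congr rfl fun i _ => ?_
  rw [← Finset.sum_add_distrib]
  refine Finset.sum_congr rfl fun i' _ => ?_
  rw [← map_add, Ring.lie_def]
  congr 1
  module

theorem ancMean_eq_sum (W : Matrix A A ℂ) (X : Matrix (S × A) (S × A) ℂ) :
    ancMean W X = ∑ i, ∑ i', W i i' • blk X i' i := by
  rw [ancMean, ptrace_eq_sum_blk, Finset.sum_comm]
  refine Finset.sum_congr rfl fun i' _ => ?_
  simp [blk_mul, blk_kronecker]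

theorem commutator_smul (c : ℂ) (X Y : Matrix S S ℂ) : ⁅X, c • Y⁆ = c • ⁅X, Y⁆ := by
  simp [Ring.lie_def, smul_sub]

theorem lie_meanH (B : β → A → Matrix D D ℂ) (χ₀ : Matrix D D ℂ) (H : Matrix (S × A) (S × A) ℂ)
    (ρ : Matrix S S ℂ) :
    ⁅meanH B χ₀ H, ρ⁆ = ∑ i, ∑ i', anc1 B χ₀ i i' • ⁅blk H i' i, ρ⁆ := by
  rw [meanH, ancMean_eq_sum]
  simp [Ring.lie_def, Finset.sum_mul, Finset.mul_sum, smul_sub]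

theorem bondTrace_stepMap₁_bondProd {B : β → A → Matrix D D ℂ} {χ₀ : Matrix D D ℂ}
    {w : D × D → ℂ} (hw : ∀ i i', anc1 B χ₀ i i' = w ⬝ᵥ mTensor B i i' *ᵥ bondVec)
    (H : Matrix (S × A) (S × A) ℂ) (ρ : Matrix S S ℂ) :
    bondTrace (stepMap₁ B H (bondProd w ρ)) = (-Complex.I) • ⁅meanH B χ₀ H, ρ⁆ := by
  rw [stepMap₁_bondProd, lie_meanH]
  simp_rw [map_sum, bondTrace_bondProd, Finset.smul_sum, hw, Matrix.dotProduct_mulVec,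
    smul_comm (-Complex.I)]

theorem bondTrace_stepMap₂_bondProd {B : β → A → Matrix D D ℂ} {χ₀ : Matrix D D ℂ}
    {w : D × D → ℂ} (hw : ∀ i i', anc1 B χ₀ i i' = w ⬝ᵥ mTensor B i i' *ᵥ bondVec)
    (H : Matrix (S × A) (S × A) ℂ) (γ : ℝ) (ρ : Matrix S S ℂ) :
    (γ : ℂ) • bondTrace (stepMap₂ B H (bondProd w ρ)) = localGen B χ₀ H γ ρ := by
  have hadd : ∀ X Y : Matrix (S × A) (S × A) ℂ, ptrace (X + Y) = ptrace X + ptrace Y := by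
    intro X Y
    simp_rw [ptrace_eq_sum_blk, blk_add, Finset.sum_add_distrib]
  rw [stepMap₂, localGen]
  simp only [LinearMap.add_apply, map_add]
  rw [bondTrace_stepMap_bondProd B _ _ w ρ hw, bondTrace_stepMap_bondProd B _ _ w ρ hw,
    bondTrace_stepMap_bondProd B _ _ w ρ hw, ← hadd, ← hadd]
  congr 2
  rw [Matrix.mul_one, Matrix.one_mul, Matrix.smul_mul, Matrix.mul_smul, Matrix.smul_mul,
    Matrix.smul_mul, Matrix.mul_smul, smul_smul, neg_mul, Complex.I_mul_I]
  module

theorem blk_lie_onFst (H : Matrix (S × A) (S × A) ℂ) (ρ : Matrix S S ℂ) (i j : A × A) :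
    blk ⁅onFst H, ρ ⊗ₖ (1 : Matrix (A × A) (A × A) ℂ)⁆ i j =
      if i.2 = j.2 then ⁅blk H i.1 j.1, ρ⁆ else 0 := by
  have h1 : ∀ i j : A × A, blk (onFst H) i j = if i.2 = j.2 then blk H i.1 j.1 else 0 := by
    intro i j
    ext s s'
    simp only [blk, onFst, Matrix.of_apply]
    split_ifs <;> rfl
  rw [Ring.lie_def, blk_sub, blk_mul, blk_mul]
  simp_rw [blk_kronecker, Matrix.one_apply]
  simp only [ite_smul, one_smul, zero_smul, mul_ite, mul_zero, ite_mul, zero_mul,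
    Finset.sum_ite_eq, Finset.sum_ite_eq', Finset.mem_univ, if_true]
  rw [h1]
  split_ifs <;> simp [Ring.lie_def]

theorem blk_lie_onSnd (H : Matrix (S × A) (S × A) ℂ) (ρ : Matrix S S ℂ) (i j : A × A) :
    blk ⁅onSnd H, ⁅onFst H, ρ ⊗ₖ (1 : Matrix (A × A) (A × A) ℂ)⁆⁆ i j =
      ⁅blk H i.2 j.2, ⁅blk H i.1 j.1, ρ⁆⁆ := by
  have h1 : ∀ i j : A × A, blk (onSnd H) i j = if i.1 = j.1 then blk H i.2 j.2 else 0 := by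
    intro i j
    ext s s'
    simp only [blk, onSnd, Matrix.of_apply]
    split_ifs <;> rfl
  rw [Ring.lie_def (onSnd H), blk_sub, blk_mul, blk_mul]
  simp_rw [h1, blk_lie_onFst, Fintype.sum_prod_type]
  simp only [mul_ite, mul_zero, ite_mul, zero_mul,
    Finset.sum_ite_eq, Finset.sum_ite_eq', Finset.sum_ite_irrel, Finset.sum_const_zero,
    Finset.mem_univ, if_true]
  rw [Ring.lie_def (blk H i.2 j.2)]

/-- Two ancillas at distance m + 1 have m ancillas between them, hence the power T^m. The limit
projection reproduces the double commutator with ⟨H⟩, and the two factors -i account for the signs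
in the kernel. -/
theorem kernel_succ_eq {B : β → A → Matrix D D ℂ} {χ₀ : Matrix D D ℂ} {w : D × D → ℂ}
    (hw : ∀ i i', anc1 B χ₀ i i' = w ⬝ᵥ mTensor B i i' *ᵥ bondVec)
    (hw₂ : ∀ (s : ℕ) (i i' : A × A), anc2 B χ₀ (s + 1) i i' =
      w ⬝ᵥ (mTensor B i.1 i'.1 * transfer B ^ s * mTensor B i.2 i'.2) *ᵥ bondVec)
    (H : Matrix (S × A) (S × A) ℂ) (m : ℕ) (ρ : Matrix S S ℂ) :
    kernel B χ₀ H (m + 1) ρ =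
      bondTrace (stepMap₁ B H (bondMul (transfer B ^ m - Matrix.vecMulVec bondVec w)
        (stepMap₁ B H (bondProd w ρ)))) := by
  have hI : ∀ X : Matrix S S ℂ, (-Complex.I) • (-Complex.I) • X = -X := by
    intro X
    rw [smul_smul, neg_mul_neg, Complex.I_mul_I, neg_one_smul]
  have h1 : bondTrace (stepMap₁ B H (bondMul (Matrix.vecMulVec bondVec w)
        (stepMap₁ B H (bondProd w ρ)))) = -⁅meanH B χ₀ H, ⁅meanH B χ₀ H, ρ⁆⁆ := by
    rw [bondMul_vecMulVec, bondTrace_stepMap₁_bondProd hw, bondTrace_stepMap₁_bondProd hw,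
      commutator_smul, hI]
  have h2 : bondTrace (stepMap₁ B H (bondMul (transfer B ^ m) (stepMap₁ B H (bondProd w ρ)))) =
      -ancMean (anc2 B χ₀ (m + 1)) ⁅onSnd H, ⁅onFst H, ρ ⊗ₖ (1 : Matrix (A × A) (A × A) ℂ)⁆⁆ := by
    rw [stepMap₁_bondProd, ancMean_eq_sum]
    simp_rw [map_sum, bondMul_bondProd, stepMap₁_bondProd, map_sum, bondTrace_bondProd, commutator_smul,
      hI, blk_lie_onSnd, hw₂, Fintype.sum_prod_type, Matrix.vecMul_vecMul,
      ← Matrix.dotProduct_mulVec, smul_neg, Finset.sum_neg_distrib]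
    refine congrArg _ (Finset.sum_congr rfl fun i _ => ?_)
    rw [Finset.sum_comm]
  rw [map_sub, LinearMap.sub_apply, map_sub, map_sub, h1, h2, kernel]
  abel

end Moments

/-! ### Second-order Taylor expansions with cubic remainder. -/

section Expansion

open Asymptotics

theorem exp_smul_isBigO {𝔸 : Type*} [NormedRing 𝔸] [NormedAlgebra ℂ 𝔸] [CompleteSpace 𝔸] (x : 𝔸) :
    (fun ε : ℝ => NormedSpace.exp ((ε : ℂ) • x) -
      (1 + (ε : ℂ) • x + (ε : ℂ) ^ 2 • ((1 / 2 : ℂ) • (x * x)))) =O[𝓝 0] fun ε : ℝ => ε ^ 3 := by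
  have h1 := (NormedSpace.exp_hasFPowerSeriesAt_zero (𝕂 := ℂ) (𝔸 := 𝔸)).isBigO_sub_partialSum_pow 3
  have h2 : Tendsto (fun ε : ℝ => (ε : ℂ) • x) (𝓝 0) (𝓝 0) := by
    have : Continuous fun ε : ℝ => (ε : ℂ) • x := by fun_prop
    simpa using this.tendsto 0
  have h3 := h1.comp_tendsto h2
  refine (h3.congr_left fun ε => ?_).trans ?_
  · simp only [Function.comp_apply, zero_add, FormalMultilinearSeries.partialSum,
      Finset.sum_range_succ, Finset.sum_range_zero, NormedSpace.expSeries_apply_eq]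
    simp only [sq, smul_smul, Nat.factorial, pow_zero, pow_one]
    norm_num
    module
  · refine IsBigO.of_bound (‖x‖ ^ 3) (Eventually.of_forall fun ε => ?_)
    simp only [Function.comp_apply, norm_pow, norm_norm]
    rw [norm_smul, Complex.norm_real, mul_pow, mul_comm]

variable {X V : Type*} [NormedAddCommGroup X] [NormedSpace ℂ X] [NormedAddCommGroup V]
  [NormedSpace ℂ V]

theorem exists_bilinear_bound [FiniteDimensional ℂ X] (F : X →ₗ[ℂ] X →ₗ[ℂ] V) :
    ∃ C : ℝ, ∀ a b : X, ‖F a b‖ ≤ C * (‖a‖ * ‖b‖) := by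
  let F' : X →L[ℂ] X →L[ℂ] V := LinearMap.toContinuousLinearMap
    ((LinearMap.toContinuousLinearMap (𝕜 := ℂ) (E := X) (F' := V)).toLinearMap ∘ₗ F)
  exact ⟨‖F'‖, fun a b => by rw [← mul_assoc]; exact F'.le_opNorm₂ a b⟩

theorem bilinear_expansion_isBigO [FiniteDimensional ℂ X] (F : X →ₗ[ℂ] X →ₗ[ℂ] V) {x y : ℝ → X} {x₀ x₁ x₂ y₀ y₁ y₂ : X}
    (hx : (fun ε : ℝ => x ε - (x₀ + (ε : ℂ) • x₁ + (ε : ℂ) ^ 2 • x₂)) =O[𝓝 0] fun ε : ℝ => ε ^ 3)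
    (hy : (fun ε : ℝ => y ε - (y₀ + (ε : ℂ) • y₁ + (ε : ℂ) ^ 2 • y₂)) =O[𝓝 0] fun ε : ℝ => ε ^ 3) :
    (fun ε : ℝ => F (x ε) (y ε) - (F x₀ y₀ + (ε : ℂ) • (F x₁ y₀ + F x₀ y₁) +
      (ε : ℂ) ^ 2 • (F x₂ y₀ + F x₀ y₂ + F x₁ y₁))) =O[𝓝 0] fun ε : ℝ => ε ^ 3 := by
  set x' : ℝ → X := fun ε => x₀ + (ε : ℂ) • x₁ + (ε : ℂ) ^ 2 • x₂ with hx'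
  set y' : ℝ → X := fun ε => y₀ + (ε : ℂ) • y₁ + (ε : ℂ) ^ 2 • y₂ with hy'
  have hbil : ∀ a b : ℝ → X, (fun ε => F (a ε) (b ε)) =O[𝓝 0] fun ε => ‖a ε‖ * ‖b ε‖ := by
    intro a b
    obtain ⟨C, hC⟩ := exists_bilinear_bound F
    refine IsBigO.of_bound C (Eventually.of_forall fun ε => ?_)
    rw [norm_mul, norm_norm, norm_norm]
    exact hC _ _
  have hone : ∀ z : ℝ → X, Continuous z → z =O[𝓝 0] fun _ : ℝ => (1 : ℝ) := fun z hz =>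
    (hz.tendsto 0).isBigO_one ℝ
  have hx'1 : x' =O[𝓝 0] fun _ : ℝ => (1 : ℝ) := hone _ (by fun_prop)
  have hy'1 : y' =O[𝓝 0] fun _ : ℝ => (1 : ℝ) := hone _ (by fun_prop)
  have h3 : (fun ε : ℝ => ε ^ 3) =O[𝓝 0] fun _ : ℝ => (1 : ℝ) :=
    ((continuous_pow 3).tendsto (0 : ℝ)).isBigO_one ℝ
  have hy1 : y =O[𝓝 0] fun _ : ℝ => (1 : ℝ) := by
    exact ((hy.trans h3).add hy'1).congr_left fun ε => sub_add_cancel _ _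
  have e1 : (fun ε => F (x ε - x' ε) (y ε)) =O[𝓝 0] fun ε : ℝ => ε ^ 3 := by
    refine (hbil _ _).trans ?_
    exact (hx.norm_left.mul hy1.norm_left).congr_right fun ε => mul_one _
  have e2 : (fun ε => F (x' ε) (y ε - y' ε)) =O[𝓝 0] fun ε : ℝ => ε ^ 3 := by
    refine (hbil _ _).trans ?_
    exact (hx'1.norm_left.mul hy.norm_left).congr_right fun ε => one_mul _
  -- These are the cross terms of order ε³ and ε⁴ in the product of the two quadratic polynomials.
  have e3 : (fun ε : ℝ => (ε ^ 3) • ((F x₁ y₂ + F x₂ y₁) + (ε : ℂ) • F x₂ y₂)) =O[𝓝 0]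
      fun ε : ℝ => ε ^ 3 := by
    have hc : Continuous fun ε : ℝ => (F x₁ y₂ + F x₂ y₁) + (ε : ℂ) • F x₂ y₂ := by fun_prop
    simpa using (isBigO_refl (fun ε : ℝ => ε ^ 3) (𝓝 0)).smul ((hc.tendsto 0).isBigO_one ℝ)
  refine ((e1.add e2).add e3).congr_left fun ε => ?_
  have hs : ∀ v : V, (ε ^ 3 : ℝ) • v = (ε : ℂ) ^ 3 • v := by
    intro v
    rw [← Complex.ofReal_pow, Complex.coe_smul]
  rw [hs]
  simp only [hx', hy', map_sub, map_add, map_smul, LinearMap.sub_apply, LinearMap.add_apply,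
    LinearMap.smul_apply]
  module

theorem toContinuousLinearMap_expansion_isBigO [FiniteDimensional ℂ X] [FiniteDimensional ℂ V]
    (F : X →ₗ[ℂ] X →ₗ[ℂ] V →ₗ[ℂ] V) {x y : ℝ → X} {x₀ x₁ x₂ y₀ y₁ y₂ : X}
    (hx : (fun ε : ℝ => x ε - (x₀ + (ε : ℂ) • x₁ + (ε : ℂ) ^ 2 • x₂)) =O[𝓝 0] fun ε : ℝ => ε ^ 3)
    (hy : (fun ε : ℝ => y ε - (y₀ + (ε : ℂ) • y₁ + (ε : ℂ) ^ 2 • y₂)) =O[𝓝 0] fun ε : ℝ => ε ^ 3) :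
    (fun ε : ℝ => LinearMap.toContinuousLinearMap (F (x ε) (y ε)) -
      (LinearMap.toContinuousLinearMap (F x₀ y₀) +
        (ε : ℂ) • LinearMap.toContinuousLinearMap (F x₁ y₀ + F x₀ y₁) +
        (ε : ℂ) ^ 2 • LinearMap.toContinuousLinearMap (F x₂ y₀ + F x₀ y₂ + F x₁ y₁)))
      =O[𝓝 0] fun ε : ℝ => ε ^ 3 := by
  have h := bilinear_expansion_isBigO (F.compr₂
    (LinearMap.toContinuousLinearMap (𝕜 := ℂ) (E := V) (F' := V)).toLinearMap) hx hy
  simpa only [LinearMap.compr₂_apply, LinearEquiv.coe_coe, map_add] using h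

end Expansion

/-! ### Expansion of a single collision in ε = gτ. -/

section CollisionExpansion

open Asymptotics
open scoped Matrix.Norms.L2Operator
attribute [local instance] Matrix.instL2OpNormedSpace

variable {S A D β : Type*} [Fintype S] [DecidableEq S] [Fintype A] [DecidableEq A]
  [Fintype D] [DecidableEq D] [Fintype β] {n : ℕ}

/-- `stepMap` is bilinear in its left and right factors, so expanding both exponentials suffices;
their quadratic coefficients are both -H²/2. -/
theorem exists_step_expansion (B : β → A → Matrix D D ℂ) {H : Matrix (S × A) (S × A) ℂ}
    (hH : H.IsHermitian) :
    ∃ c : ℝ, 0 ≤ c ∧ ∀ᶠ ε in 𝓝 (0 : ℝ),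
      ‖LinearMap.toContinuousLinearMap (stepMap B (collisionU H 1 ε) (collisionU H 1 ε)ᴴ) -
        (LinearMap.toContinuousLinearMap (bondMul (transfer B)) +
          (ε : ℂ) • LinearMap.toContinuousLinearMap (stepMap₁ B H) +
          (ε : ℂ) ^ 2 • LinearMap.toContinuousLinearMap (stepMap₂ B H))‖ ≤ c * |ε| ^ 3 := by
  have hx := exp_smul_isBigO ((-Complex.I) • H)
  have hy := exp_smul_isBigO (Complex.I • H)
  have hxx : ((-Complex.I) • H) * ((-Complex.I) • H) = -(H * H) := by
    rw [Matrix.smul_mul, Matrix.mul_smul, smul_smul, neg_mul_neg, Complex.I_mul_I, neg_one_smul]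
  have hyy : (Complex.I • H) * (Complex.I • H) = -(H * H) := by
    rw [Matrix.smul_mul, Matrix.mul_smul, smul_smul, Complex.I_mul_I, neg_one_smul]
  rw [hxx] at hx
  rw [hyy] at hy
  have h1 := toContinuousLinearMap_expansion_isBigO (stepMap (S := S) B) hx hy
  obtain ⟨c, hc, hb⟩ := h1.exists_nonneg
  refine ⟨c, hc, hb.bound.mono fun ε hε => ?_⟩
  have e1 : collisionU H 1 ε = NormedSpace.exp ((ε : ℂ) • (-Complex.I) • H) := by
    rw [collisionU, smul_smul, one_mul]
    congr 2
    ring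
  have e2 : (collisionU H 1 ε)ᴴ = NormedSpace.exp ((ε : ℂ) • Complex.I • H) := by
    rw [collisionU_conjTranspose hH, smul_smul, one_mul]
    congr 2
    ring
  rw [norm_pow, Real.norm_eq_abs] at hε
  refine le_trans (le_of_eq ?_) hε
  rw [e2, e1, ← stepMap_one_one, stepMap₁, stepMap₂]
  simp only [smul_neg, neg_smul]

end CollisionExpansion

/-! ### Application to the collision model: generators, kernel sums and convergence. -/

section MasterEquation

open scoped Matrix.Norms.L2Operator
attribute [local instance] Matrix.instL2OpNormedSpace

theorem summable_toContinuousLinearMap {P V : Type*} [AddCommGroup P] [Module ℂ P]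
    [TopologicalSpace P] [IsTopologicalAddGroup P] [ContinuousSMul ℂ P] [T2Space P]
    [FiniteDimensional ℂ P] [NormedAddCommGroup V] [NormedSpace ℂ V] [FiniteDimensional ℂ V]
    (F : P →ₗ[ℂ] V →ₗ[ℂ] V) {f : ℕ → P} (hf : Summable f) :
    Summable fun m => LinearMap.toContinuousLinearMap (F (f m)) :=
  hf.mapL (LinearMap.toContinuousLinearMap
    ((LinearMap.toContinuousLinearMap (𝕜 := ℂ) (E := V) (F' := V)).toLinearMap ∘ₗ F))

theorem exists_solution_linear {M : Type*} [NormedAddCommGroup M] [NormedSpace ℂ M]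
    [NormedSpace ℝ M] [IsScalarTower ℝ ℂ M] [FiniteDimensional ℂ M] (G : M →ₗ[ℂ] M) (x : M) :
    ∃ r : ℝ → M, r 0 = x ∧ ∀ t : ℝ, HasDerivAt r (G (r t)) t := by
  have : CompleteSpace M := FiniteDimensional.complete ℂ M
  let G' : M →L[ℝ] M := (LinearMap.toContinuousLinearMap G).restrictScalars ℝ
  refine ⟨fun t => NormedSpace.exp (t • G') x, by simp, fun t => ?_⟩
  have h := (hasDerivAt_exp_smul_const' (𝕂 := ℝ) G' t).clm_apply (hasDerivAt_const t x)
  simpa [G'] using h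

variable {S A D β : Type*} [Fintype S] [DecidableEq S] [Fintype A] [DecidableEq A]
  [Fintype D] [DecidableEq D] [Fintype β] {n : ℕ}

theorem toContinuousLinearMap_bondMul_pow_sub (T : Matrix (D × D) (D × D) ℂ) (w : D × D → ℂ)
    (m : ℕ) :
    LinearMap.toContinuousLinearMap (bondMul (S := S) T) ^ m -
      LinearMap.toContinuousLinearMap (bondProd w) ∘L LinearMap.toContinuousLinearMap bondTrace =
    LinearMap.toContinuousLinearMap (bondMul (T ^ m - Matrix.vecMulVec bondVec w)) := by
  have h1 : LinearMap.toContinuousLinearMap (bondMul (S := S) T) ^ m =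
      LinearMap.toContinuousLinearMap (bondMul (T ^ m)) := by
    induction m with
    | zero =>
      refine ContinuousLinearMap.ext fun Z => ?_
      exact (bondMul_one Z).symm
    | succ m ih =>
      refine ContinuousLinearMap.ext fun Z => ?_
      rw [pow_succ', ih]
      exact (bondMul_mul _ _ _).symm
  refine ContinuousLinearMap.ext fun Z => ?_
  rw [h1, map_sub, sub_apply]
  simp [bondMul_vecMulVec]

theorem star_anc1 {B : β → A → Matrix D D ℂ} (hB : RightNormalized B) {χ₀ : Matrix D D ℂ}
    (hχ₀ : χ₀.IsHermitian) (i i' : A) : star (anc1 B χ₀ i i') = anc1 B χ₀ i' i := by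
  simp_rw [anc1, siteState_mpdo hB]
  simp only [Fin.val_zero, pow_zero, Matrix.vecMul_one, dotProduct, mulVec_bondVec, mTensor_apply,
    Fintype.sum_prod_type, star_sum, star_mul', star_star, hχ₀.apply]
  rw [Finset.sum_comm]
  simp only [mul_comm]

theorem isHermitian_meanH {B : β → A → Matrix D D ℂ} (hB : RightNormalized B)
    {χ₀ : Matrix D D ℂ} (hχ₀ : χ₀.IsHermitian)
    {H : Matrix (S × A) (S × A) ℂ} (hH : H.IsHermitian) : (meanH B χ₀ H).IsHermitian := by
  have h2 : ∀ i i', (blk H i i')ᴴ = blk H i' i := by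
    intro i i'
    rw [← blk_conjTranspose, hH.eq]
  rw [Matrix.IsHermitian, meanH, ancMean_eq_sum]
  simp_rw [Matrix.conjTranspose_sum, Matrix.conjTranspose_smul, star_anc1 hB hχ₀, h2]
  exact Finset.sum_comm

/-- After division by τ = ε²/γ the first-order term would be of order 1/ε, so it has to vanish; the
second-order term gives the limit. -/
theorem tendsto_increment_of_expansion {V M : Type*} [NormedAddCommGroup V] [NormedSpace ℂ V]
    [NormedAddCommGroup M] [NormedSpace ℂ M] {E₀ E₁ E₂ : V →L[ℂ] V} {W : V →L[ℂ] M}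
    {E : ℝ → V →L[ℂ] V} {c : ℝ}
    (hE : ∀ᶠ ε in 𝓝 (0 : ℝ), ‖E ε - (E₀ + (ε : ℂ) • E₁ + (ε : ℂ) ^ 2 • E₂)‖ ≤ c * |ε| ^ 3)
    {ι : Type*} {l : Filter ι} {γ : ℝ} {g τ : ι → ℝ} (hτ : ∀ n, 0 < τ n)
    (hgγ : ∀ n, g n ^ 2 * τ n = γ) (hlim : Tendsto (fun n => g n * τ n) l (𝓝 0))
    {x : V} (hx : W (E₁ x) = 0) :
    Tendsto (fun n => (((τ n)⁻¹ : ℝ) : ℂ) • (W (E (g n * τ n) x) - W (E₀ x))) l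
      (𝓝 ((γ : ℂ) • W (E₂ x))) := by
  rw [tendsto_iff_norm_sub_tendsto_zero]
  have h0 : Tendsto (fun n => ‖W‖ * c * γ * ‖x‖ * |g n * τ n|) l (𝓝 0) := by
    simpa using hlim.abs.const_mul (‖W‖ * c * γ * ‖x‖)
  refine squeeze_zero' (Eventually.of_forall fun n => norm_nonneg _) ?_ h0
  filter_upwards [hlim.eventually hE] with n hn
  set ε := g n * τ n with hε
  have hε2 : ε ^ 2 = γ * τ n := by rw [hε, ← hgγ n]; ring
  have h1 : (((τ n)⁻¹ : ℝ) : ℂ) * (ε : ℂ) ^ 2 = γ := by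
    rw [← Complex.ofReal_pow, ← Complex.ofReal_mul, hε2, mul_comm γ, inv_mul_cancel_left₀ (hτ n).ne']
  have h2 : (((τ n)⁻¹ : ℝ) : ℂ) • (W (E ε x) - W (E₀ x)) - (γ : ℂ) • W (E₂ x) =
      (((τ n)⁻¹ : ℝ) : ℂ) • W ((E ε - (E₀ + (ε : ℂ) • E₁ + (ε : ℂ) ^ 2 • E₂)) x) := by
    simp only [sub_apply, add_apply, smul_apply, map_sub, map_add, map_smul, hx, smul_zero,
      ← h1, add_zero]
    module
  rw [h2, norm_smul, Complex.norm_real, Real.norm_of_nonneg (inv_nonneg.2 (hτ n).le)]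
  calc (τ n)⁻¹ * ‖W ((E ε - (E₀ + (ε : ℂ) • E₁ + (ε : ℂ) ^ 2 • E₂)) x)‖
      ≤ (τ n)⁻¹ * (‖W‖ * (c * |ε| ^ 3 * ‖x‖)) := by
        have := (hτ n).le
        gcongr
        exact (W.le_opNorm _).trans (by gcongr; exact (ContinuousLinearMap.le_opNorm _ _).trans (by gcongr))
    _ = ‖W‖ * c * γ * ‖x‖ * |ε| := by
        have h3 : |ε| ^ 3 = γ * τ n * |ε| := by rw [pow_succ, sq_abs, hε2]
        rw [h3]
        field_simp [(hτ n).ne']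

theorem vecMul_transfer_eq {B : β → A → Matrix D D ℂ} {χ₀ : Matrix D D ℂ} (hχ₀ : IsDensity χ₀)
    {w : D × D → ℂ}
    (hw : Tendsto (fun m : ℕ => transfer B ^ m) atTop (𝓝 (Matrix.vecMulVec bondVec w))) :
    w ᵥ* transfer B = w := by
  have h1 := tendsto_vecMul_transfer_pow hχ₀ hw
  have h2 : Continuous fun v : D × D → ℂ => v ᵥ* transfer B :=
    continuous_id.matrix_vecMul continuous_const
  refine tendsto_nhds_unique ((h2.tendsto _).comp h1) ?_
  refine ((tendsto_add_atTop_iff_nat 1).2 h1).congr fun m => ?_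
  rw [Function.comp_apply, Matrix.vecMul_vecMul, pow_succ]

/-- Equivalence of norms in finite dimension: passes from the entrywise bound to the operator norm
used in the convergence argument. -/
theorem exists_norm_le_of_forall_apply_le : ∃ C : ℝ, ∀ (Z : D × D → Matrix S S ℂ),
    (∀ c s s', ‖Z c s s'‖ ≤ 1) → ‖Z‖ ≤ C := by
  let e : (D × D → S → S → ℂ) →ₗ[ℂ] (D × D → Matrix S S ℂ) := 
    { toFun := fun Z c => Matrix.of (Z c)
      map_add' := fun _ _ => rfl
      map_smul' := fun _ _ => rfl }
  refine ⟨‖LinearMap.toContinuousLinearMap e‖, fun Z hZ => ?_⟩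
  have h1 : ‖fun c s s' => Z c s s'‖ ≤ 1 := by
    simp_rw [pi_norm_le_iff_of_nonneg zero_le_one]
    exact hZ
  exact (LinearMap.toContinuousLinearMap e).le_of_opNorm_le_of_le le_rfl h1 |>.trans (mul_one _).le

theorem collisionU_eq (H : Matrix (S × A) (S × A) ℂ) (g τ : ℝ) :
    collisionU H g τ = collisionU H 1 (g * τ) := by
  rw [collisionU, collisionU, one_mul]

/-- The nonlocal part of the generator: the sum of the memory kernel over all distances. -/
def memoryGen (B : β → A → Matrix D D ℂ) (H : Matrix (S × A) (S × A) ℂ) (w : D × D → ℂ) :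
    Matrix S S ℂ →ₗ[ℂ] Matrix S S ℂ :=
  (effMemory (LinearMap.toContinuousLinearMap (bondMul (transfer B)))
    (LinearMap.toContinuousLinearMap (stepMap₁ B H)) (LinearMap.toContinuousLinearMap bondTrace)
    (LinearMap.toContinuousLinearMap (bondProd w))).toLinearMap

section Reduction

variable {B : β → A → Matrix D D ℂ} {χ₀ : Matrix D D ℂ} {w : D × D → ℂ}

theorem bondTrace_comp_bondProd (hwu : w ⬝ᵥ bondVec = 1) :
    LinearMap.toContinuousLinearMap (bondTrace (S := S)) ∘L
      LinearMap.toContinuousLinearMap (bondProd w) = 1 := by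
  refine ContinuousLinearMap.ext fun X => ?_
  exact (bondTrace_bondProd w X).trans (by rw [hwu, one_smul]; rfl)

theorem bondTrace_comp_bondMul (hB : RightNormalized B) :
    LinearMap.toContinuousLinearMap (bondTrace (S := S)) ∘L
      LinearMap.toContinuousLinearMap (bondMul (transfer B)) =
      LinearMap.toContinuousLinearMap bondTrace :=
  ContinuousLinearMap.ext fun Z => bondTrace_bondMul (transfer_mulVec_bondVec hB) Z

theorem bondMul_comp_bondProd (hwT : w ᵥ* transfer B = w) :
    LinearMap.toContinuousLinearMap (bondMul (S := S) (transfer B)) ∘L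
      LinearMap.toContinuousLinearMap (bondProd w) =
      LinearMap.toContinuousLinearMap (bondProd w) := by
  refine ContinuousLinearMap.ext fun X => ?_
  exact (bondMul_bondProd _ w X).trans (by rw [hwT]; rfl)

theorem summable_bondMul_pow_sub
    (hsum : Summable fun m : ℕ => transfer B ^ m - Matrix.vecMulVec bondVec w) :
    Summable fun m : ℕ => LinearMap.toContinuousLinearMap (bondMul (S := S) (transfer B)) ^ m -
      LinearMap.toContinuousLinearMap (bondProd w) ∘L
        LinearMap.toContinuousLinearMap bondTrace := by
  have h := summable_toContinuousLinearMap (bondMul (S := S) (D := D)) hsum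
  simp_rw [toContinuousLinearMap_bondMul_pow_sub]
  exact h

theorem hasSum_kernel (hB : RightNormalized B) (hwu : w ⬝ᵥ bondVec = 1)
    (hsum : Summable fun m : ℕ => transfer B ^ m - Matrix.vecMulVec bondVec w)
    (hw : ∀ i i', anc1 B χ₀ i i' = w ⬝ᵥ mTensor B i i' *ᵥ bondVec)
    (hw₂ : ∀ (s : ℕ) (i i' : A × A), anc2 B χ₀ (s + 1) i i' =
      w ⬝ᵥ (mTensor B i.1 i'.1 * transfer B ^ s * mTensor B i.2 i'.2) *ᵥ bondVec)
    (H : Matrix (S × A) (S × A) ℂ) (ρ : Matrix S S ℂ) :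
    HasSum (fun m : ℕ => kernel B χ₀ H (m + 1) ρ) (memoryGen B H w ρ) := by
  have h := hasSum_effMemory (E₁ := LinearMap.toContinuousLinearMap (stepMap₁ B H))
    (bondTrace_comp_bondMul (S := S) hB) (summable_bondMul_pow_sub hsum)
    (bondTrace_comp_bondProd hwu) ρ
  simp_rw [toContinuousLinearMap_bondMul_pow_sub] at h
  exact h.congr_fun fun m => kernel_succ_eq hw hw₂ H m ρ

theorem effGen₁_eq (hw : ∀ i i', anc1 B χ₀ i i' = w ⬝ᵥ mTensor B i i' *ᵥ bondVec)
    (H : Matrix (S × A) (S × A) ℂ) (ρ : Matrix S S ℂ) :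
    effGen₁ (LinearMap.toContinuousLinearMap (stepMap₁ B H))
      (LinearMap.toContinuousLinearMap bondTrace)
      (LinearMap.toContinuousLinearMap (bondProd w)) ρ = (-Complex.I) • ⁅meanH B χ₀ H, ρ⁆ :=
  bondTrace_stepMap₁_bondProd hw H ρ

theorem smul_effGen₂_eq (hw : ∀ i i', anc1 B χ₀ i i' = w ⬝ᵥ mTensor B i i' *ᵥ bondVec)
    (H : Matrix (S × A) (S × A) ℂ) (γ : ℝ) (ρ : Matrix S S ℂ) :
    (γ : ℂ) • effGen₂ (LinearMap.toContinuousLinearMap (bondMul (transfer B)))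
      (LinearMap.toContinuousLinearMap (stepMap₁ B H))
      (LinearMap.toContinuousLinearMap (stepMap₂ B H))
      (LinearMap.toContinuousLinearMap bondTrace)
      (LinearMap.toContinuousLinearMap (bondProd w)) ρ =
      localGen B χ₀ H γ ρ + (γ : ℂ) • memoryGen B H w ρ := by
  rw [← bondTrace_stepMap₂_bondProd hw, ← smul_add]
  rfl

theorem exists_kernelExpansion
    (hcorr : FiniteCorrelationLength B)
    (hlim : Tendsto (fun m : ℕ => transfer B ^ m) atTop (𝓝 (Matrix.vecMulVec bondVec w)))
    (hw : ∀ i i', anc1 B χ₀ i i' = w ⬝ᵥ mTensor B i i' *ᵥ bondVec)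
    (hw₂ : ∀ (s : ℕ) (i i' : A × A), anc2 B χ₀ (s + 1) i i' =
      w ⬝ᵥ (mTensor B i.1 i'.1 * transfer B ^ s * mTensor B i.2 i'.2) *ᵥ bondVec)
    (H : Matrix (S × A) (S × A) ℂ)
    (hT : Module.End.IsSemisimple (Matrix.toLin' (transfer B))) (hdet : IsUnit (transfer B).det) :
    ∃ L, IsKernelExpansion B χ₀ H L := by
  obtain ⟨Q, hQ⟩ := exists_pow_sub_eq_sum_of_isSemisimple hT
    (fun z hz h1 => hcorr z ((Multiset.mem_erase_of_ne h1).2 hz)) hlim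
  -- The factor z⁻¹ shifts the exponent from m - 1, the number of ancillas in between, to m. This is
  -- where a zero eigenvalue has to be excluded.
  refine ⟨fun z => z⁻¹ • (bondTrace ∘ₗ stepMap₁ B H ∘ₗ bondMul (Q z) ∘ₗ stepMap₁ B H ∘ₗ bondProd w),
    fun m hm ρ => ?_⟩
  obtain ⟨k, rfl⟩ : ∃ k, m = k + 1 := ⟨m - 1, by omega⟩
  have hsub : subleading B =
      (transfer B).charpoly.roots.toFinset.filter (fun z => ‖z‖ < 1) := by
    ext z
    simp [subleading]
  rw [kernel_succ_eq hw hw₂, hQ, hsub]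
  simp only [map_sum, LinearMap.sum_apply, map_smul, LinearMap.smul_apply, LinearMap.comp_apply]
  refine Finset.sum_congr rfl fun z hz => ?_
  have hz0 : z ≠ 0 := by
    rintro rfl
    have h1 := (Finset.mem_filter.1 hz).1
    rw [Multiset.mem_toFinset, Polynomial.mem_roots (transfer B).charpoly_monic.ne_zero,
      Polynomial.IsRoot.def, Matrix.eval_charpoly] at h1
    rw [map_zero, zero_sub, Matrix.det_neg] at h1
    exact hdet.ne_zero (by simpa using h1)
  rw [smul_smul, pow_succ, mul_inv_cancel_right₀ hz0]

/-- Geometric series starting at exponent 1: ∑_{m ≥ 1} z^m = z / (1 - z). -/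
theorem eq_sum_of_isKernelExpansion {N : Matrix S S ℂ →ₗ[ℂ] Matrix S S ℂ}
    {H : Matrix (S × A) (S × A) ℂ}
    (hN : ∀ ρ, HasSum (fun m : ℕ => kernel B χ₀ H (m + 1) ρ) (N ρ))
    {L : ℂ → Matrix S S ℂ →ₗ[ℂ] Matrix S S ℂ} (hL : IsKernelExpansion B χ₀ H L) :
    N = ∑ z ∈ subleading B, (z / (1 - z)) • L z := by
  refine LinearMap.ext fun ρ => (hN ρ).unique ?_
  simp_rw [hL _ (Nat.le_add_left 1 _) ρ, LinearMap.sum_apply, LinearMap.smul_apply]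
  refine hasSum_sum fun z hz => ?_
  have hz1 : ‖z‖ < 1 := by
    rw [subleading] at hz
    exact (Finset.mem_filter.1 hz).2
  have h := ((hasSum_geometric_of_norm_lt_one hz1).mul_left z).smul_const (L z ρ)
  simpa only [← pow_succ', div_eq_mul_inv] using h

theorem tendsto_localIncrement (hB : RightNormalized B) (hwu : w ⬝ᵥ bondVec = 1)
    (hw : ∀ i i', anc1 B χ₀ i i' = w ⬝ᵥ mTensor B i i' *ᵥ bondVec)
    {H : Matrix (S × A) (S × A) ℂ} (hH : H.IsHermitian) {γ : ℝ}
    {ι : Type*} {l : Filter ι} {g τ : ι → ℝ} (hτ : ∀ n, 0 < τ n) (hgγ : ∀ n, g n ^ 2 * τ n = γ)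
    (hlim : Tendsto (fun n => g n * τ n) l (𝓝 0)) {ρ : Matrix S S ℂ}
    (hρ : ⁅meanH B χ₀ H, ρ⁆ = 0) :
    Tendsto (fun n => localIncrement B χ₀ H (g n) (τ n) ρ) l (𝓝 (localGen B χ₀ H γ ρ)) := by
  obtain ⟨c, -, hE⟩ := exists_step_expansion (S := S) B hH
  have h1 := tendsto_increment_of_expansion
    (W := LinearMap.toContinuousLinearMap (bondTrace (S := S) (D := D))) hE hτ hgγ hlim
    (x := bondProd w ρ) (by
      refine (bondTrace_stepMap₁_bondProd hw H ρ).trans ?_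
      rw [hρ, smul_zero])
  rw [← bondTrace_stepMap₂_bondProd hw]
  have h2 : bondTrace (bondMul (transfer B) (bondProd w ρ)) = ρ := by
    rw [bondTrace_bondMul (transfer_mulVec_bondVec hB), bondTrace_bondProd, hwu, one_smul]
  have h3 : ∀ n, localIncrement B χ₀ H (g n) (τ n) ρ = (((τ n)⁻¹ : ℝ) : ℂ) •
      (bondTrace (stepMap B (collisionU H 1 (g n * τ n)) (collisionU H 1 (g n * τ n))ᴴ
        (bondProd w ρ)) - bondTrace (bondMul (transfer B) (bondProd w ρ))) := by
    intro n
    rw [localIncrement, collisionU_eq, ← bondTrace_stepMap_bondProd B _ _ w ρ hw, h2]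
  simp_rw [h3]
  exact h1

theorem tendstoUniformlyOn_systemState (hB : RightNormalized B) (hχ₀ : IsDensity χ₀)
    (hwu : w ⬝ᵥ bondVec = 1) (hwT : w ᵥ* transfer B = w)
    (hsum : Summable fun m : ℕ => transfer B ^ m - Matrix.vecMulVec bondVec w)
    (hw : ∀ i i', anc1 B χ₀ i i' = w ⬝ᵥ mTensor B i i' *ᵥ bondVec)
    {H : Matrix (S × A) (S × A) ℂ} (hH : H.IsHermitian) {γ : ℝ} (hγ : 0 < γ)
    {ι : Type*} {l : Filter ι} {g τ : ι → ℝ} (hτ : ∀ n, 0 < τ n) (hgγ : ∀ n, g n ^ 2 * τ n = γ)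
    (hlim : Tendsto (fun n => g n * τ n) l (𝓝 0)) {ρ₀ : Matrix S S ℂ} (hρ₀ : IsDensity ρ₀)
    {r : ℝ → Matrix S S ℂ}
    (hr : IsSolution (fun ρ => localGen B χ₀ H γ ρ + (γ : ℂ) • memoryGen B H w ρ) ρ₀ r)
    (hvanish : (∀ t : ℝ, 0 ≤ t → ⁅meanH B χ₀ H, r t⁆ = 0) ∨
      (∀ t₁ : ℝ, TendstoUniformlyOn
        (fun n t => (-(Complex.I * (g n : ℂ))) • ⁅meanH B χ₀ H,
          systemState B χ₀ H (g n) (τ n) ρ₀ ⌊t / τ n⌋₊⁆) (fun _ => 0) l (Set.Icc 0 t₁)))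
    (t₁ : ℝ) :
    TendstoUniformlyOn (fun n t => systemState B χ₀ H (g n) (τ n) ρ₀ ⌊t / τ n⌋₊) r l
      (Set.Icc 0 t₁) := by
  obtain ⟨c, hc, hE⟩ := exists_step_expansion (S := S) B hH
  obtain ⟨R, hR⟩ := exists_norm_le_of_forall_apply_le (S := S) (D := D)
  simp_rw [systemState_eq_iterate] at hvanish ⊢
  have hh := isHermitian_meanH (S := S) hB hχ₀.1.1 hH
  refine tendstoUniformlyOn_of_effective_generator
    (W := LinearMap.toContinuousLinearMap (bondTrace (S := S) (D := D)))
    (J := LinearMap.toContinuousLinearMap (bondProd w))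
    (E₁ := LinearMap.toContinuousLinearMap (stepMap₁ B H))
    (E₂ := LinearMap.toContinuousLinearMap (stepMap₂ B H))
    (E := fun ε => LinearMap.toContinuousLinearMap
      (stepMap B (collisionU H 1 ε) (collisionU H 1 ε)ᴴ))
    (Φ := fun n k => (stepMap B (collisionU H (g n) (τ n)) (collisionU H (g n) (τ n))ᴴ)^[k]
      (bondProd (fun p : D × D => χ₀ p.1 p.2) ρ₀))
    (bondTrace_comp_bondProd hwu) (bondTrace_comp_bondMul hB) (bondMul_comp_bondProd hwT)
    (summable_bondMul_pow_sub hsum) hc hE (b := 2 * ‖meanH B χ₀ H‖ ^ 2) (by positivity)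
    (fun ε X => ?_) hγ hτ hgγ hlim (R := R) (fun n k => hR _ fun c s s' => ?_) (fun n k => ?_)
    (fun n => ?_) (fun t ht => ?_) (hvanish.imp (fun h t ht => ?_) fun h t₁ => ?_) t₁
  · rw [effGen₁_eq hw]
    exact norm_add_smul_commutator_le hh ε X
  · exact norm_iterate_stepMap_apply_le hB hχ₀ hρ₀ (collisionU_conjTranspose_mul_self hH _ _) k c s s'
  · rw [Function.iterate_succ_apply', collisionU_eq]
    rfl
  · refine (bondTrace_bondProd _ _).trans ?_
    have h1 : ∑ d, χ₀ d d = 1 := hχ₀.2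
    -- The bond starts in χ₀ rather than w, yet its contraction is exactly ρ₀ because χ₀ has unit
    -- trace; the relaxation of the bond is absorbed by the correctors.
    rw [dotProduct_bondVec, h1, one_smul, hr.1]
  · rw [smul_effGen₂_eq hw]
    exact hr.2 t ht
  · rw [effGen₁_eq hw, h t ht, smul_zero]
  · refine (h t₁).congr (Eventually.of_forall fun n t _ => ?_)
    simp only
    rw [effGen₁_eq hw, smul_smul]
    congr 1
    ring

theorem exists_isSolution (hw : ∀ i i', anc1 B χ₀ i i' = w ⬝ᵥ mTensor B i i' *ᵥ bondVec)
    (H : Matrix (S × A) (S × A) ℂ) (γ : ℝ) (ρ₀ : Matrix S S ℂ) :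
    ∃ r, IsSolution (fun ρ => localGen B χ₀ H γ ρ + (γ : ℂ) • memoryGen B H w ρ) ρ₀ r := by
  obtain ⟨r, hr₀, hr⟩ := exists_solution_linear
    ((γ : ℂ) • (bondTrace ∘ₗ stepMap₂ B H ∘ₗ bondProd w + memoryGen B H w)) ρ₀
  refine ⟨r, hr₀, fun t _ => ?_⟩
  simp_rw [← bondTrace_stepMap₂_bondProd hw, ← smul_add]
  exact (hr t).hasDerivWithinAt

end Reduction

end MasterEquation

end Stroboscopic

end

/-! ### The theorem: the stationary row w is chosen once and feeds all the items. -/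

theorem proposition4 {S A D β ι : Type*} [Fintype S] [DecidableEq S] [Fintype A] [DecidableEq A]
    [Fintype D] [DecidableEq D] [Fintype β]
    (B : β → A → Matrix D D ℂ) (hB : Stroboscopic.RightNormalized B)
    (χ₀ : Matrix D D ℂ) (hχ₀ : Stroboscopic.IsDensity χ₀)
    (hhom : Stroboscopic.IsHomogeneous B χ₀)
    (hcorr : Stroboscopic.FiniteCorrelationLength B)
    (H : Matrix (S × A) (S × A) ℂ) (hH : H.IsHermitian)
    (γ : ℝ) (hγ : 0 < γ)
    (l : Filter ι) (g τ : ι → ℝ) (hτ : ∀ n, 0 < τ n) (hgγ : ∀ n, g n ^ 2 * τ n = γ)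
    (hlim : Tendsto (fun n => g n * τ n) l (𝓝 0)) :
    -- the local part is the limit of the single-collision increment rate
    (∀ ρ : Matrix S S ℂ, ⁅Stroboscopic.meanH B χ₀ H, ρ⁆ = 0 →
      Tendsto (fun n => Stroboscopic.localIncrement B χ₀ H (g n) (τ n) ρ) l
        (𝓝 (Stroboscopic.localGen B χ₀ H γ ρ))) ∧
    -- the expansion of the kernel over the subleading eigenvalues exists if the transfer
    -- matrix is diagonalizable and has no zero eigenvalue
    (Module.End.IsSemisimple (Matrix.toLin' (Stroboscopic.transfer B)) →
      IsUnit (Stroboscopic.transfer B).det →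
      ∃ L, Stroboscopic.IsKernelExpansion B χ₀ H L) ∧
    -- the nonlocal part `N = ∑_{m ≥ 1} K_m` of the generator
    ∃ N : Matrix S S ℂ →ₗ[ℂ] Matrix S S ℂ,
      (∀ ρ, HasSum (fun m : ℕ => Stroboscopic.kernel B χ₀ H (m + 1) ρ) (N ρ)) ∧
      -- equals `∑_j λ_j / (1 - λ_j) L^{(j)}` for every expansion of the kernel
      (∀ L, Stroboscopic.IsKernelExpansion B χ₀ H L →
        N = ∑ z ∈ Stroboscopic.subleading B, (z / (1 - z)) • L z) ∧
      -- and the system dynamics is governed by the master equation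
      ∀ ρ₀ : Matrix S S ℂ, Stroboscopic.IsDensity ρ₀ →
        (∃ r, Stroboscopic.IsSolution
          (fun ρ => Stroboscopic.localGen B χ₀ H γ ρ + (γ : ℂ) • N ρ) ρ₀ r) ∧
        ∀ r, Stroboscopic.IsSolution
            (fun ρ => Stroboscopic.localGen B χ₀ H γ ρ + (γ : ℂ) • N ρ) ρ₀ r →
          ((∀ t : ℝ, 0 ≤ t → ⁅Stroboscopic.meanH B χ₀ H, r t⁆ = 0) ∨
            (∀ t₁ : ℝ, TendstoUniformlyOn
              (fun n t => (-(Complex.I * (g n : ℂ))) • ⁅Stroboscopic.meanH B χ₀ H,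
                Stroboscopic.systemState B χ₀ H (g n) (τ n) ρ₀ ⌊t / τ n⌋₊⁆)
              (fun _ => 0) l (Set.Icc 0 t₁))) →
          ∀ t₁ : ℝ, TendstoUniformlyOn
            (fun n t => Stroboscopic.systemState B χ₀ H (g n) (τ n) ρ₀ ⌊t / τ n⌋₊)
            r l (Set.Icc 0 t₁) := by
  have hu := Stroboscopic.bondVec_ne_zero hχ₀
  obtain ⟨w, hwu, hsum⟩ := Stroboscopic.exists_summable_pow_sub_vecMulVec hu
    (Stroboscopic.transfer_mulVec_bondVec hB) hcorr
  have hTlim : Tendsto (fun m : ℕ => Stroboscopic.transfer B ^ m) atTop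
      (𝓝 (Matrix.vecMulVec Stroboscopic.bondVec w)) := by
    simpa using hsum.tendsto_atTop_zero.add_const (Matrix.vecMulVec Stroboscopic.bondVec w)
  have hw := Stroboscopic.anc1_eq hB hχ₀ hhom hTlim
  have hw₂ := Stroboscopic.anc2_eq hB hχ₀ hhom hTlim
  have hN := Stroboscopic.hasSum_kernel hB hwu hsum hw hw₂ H
  exact ⟨fun ρ hρ => Stroboscopic.tendsto_localIncrement hB hwu hw hH hτ hgγ hlim hρ,
    Stroboscopic.exists_kernelExpansion hcorr hTlim hw hw₂ H,
    Stroboscopic.memoryGen B H w, hN,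
    fun L hL => Stroboscopic.eq_sum_of_isKernelExpansion hN hL,
    fun ρ₀ hρ₀ => ⟨Stroboscopic.exists_isSolution hw H γ ρ₀, fun r hr hv =>
      Stroboscopic.tendstoUniformlyOn_systemState hB hχ₀ hwu
        (Stroboscopic.vecMul_transfer_eq hχ₀ hTlim) hsum hw hH hγ hτ hgγ hlim hρ₀ hr hv⟩⟩
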